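/- Fix an integer $k\ge 1$. The uniform attachment graph $G_{n,k}$ is the random graph on the vertex set $[n]=\{1,\dots,n\}$ in which each vertex $j\in\{2,\dots,n\}$ makes $k$ choices from $\{1,\dots,j-1\}$, all choices (of all vertices) being mutually independent and each being uniform on its range (so repetitions are allowed), and $j$ is joined by an edge to each vertex that it chose; edge orientations and multiplicities are disregarded, so that $G_{n,k}$ is a simple undirected graph. A graph is Hamiltonian if it has a cycle that contains all its vertices. **Theorem.** With high probability $G_{n,13}$ is Hamiltonian, that is, $$\lim_{n\to\infty}\mathbb P\big(G_{n,13}\text{ is Hamiltonian}\big)=1 .$$ -/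

import Mathlib

open MeasureTheory Filter Topology

namespace UniformAttachment

/-- The outcomes of all the choices made in the uniform attachment process with `n` vertices and
parameter `k`. The vertices `1, …, n` of the usual description are `0, …, n - 1` here. For
`i < n - 1` and `l < k`, the value `c (i, l)` is the `l`-th choice of the vertex `i + 1`, an
element of the set `{0, …, i}` of the vertices that arrived before it. The first vertex makes no
choice. -/
abbrev Choices (n k : ℕ) : Type :=
  (p : Fin (n - 1) × Fin k) → Fin (p.1.val + 1)

/-- The law of the choices: they are mutually independent, and each is uniformly distributed on
the set of the earlier vertices. -/
noncomputable def choiceMeasure (n k : ℕ) : Measure (Choices n k) :=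
  Measure.pi fun p : Fin (n - 1) × Fin k =>
    (PMF.uniformOfFintype (Fin (p.1.val + 1))).toMeasure

instance (n k : ℕ) : IsProbabilityMeasure (choiceMeasure n k) := by
  unfold choiceMeasure
  infer_instance

/-- The uniform attachment graph determined by the choices `c`: every vertex `i + 1` is joined to
each vertex that it chose. Orientations and multiplicities of edges are disregarded. -/
def graph (n k : ℕ) (c : Choices n k) : SimpleGraph (Fin n) :=
  SimpleGraph.fromRel fun v u =>
    ∃ p : Fin (n - 1) × Fin k, v.val = p.1.val + 1 ∧ u.val = (c p).val

end UniformAttachment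

/-! Split the thirteen choices of each vertex as 6 + 6 + 1. With high probability the first twelve
give an expander that has an ordering of all vertices with very few gaps, that is, consecutive
non-adjacent pairs. The thirteenth choices, revealed one at a time, then remove the gaps and close
the cycle.

Expansion. A first-moment bound over pairs of unjoined sets shows that every nonempty set of at most
n/50 vertices has a closed neighbourhood more than three times its size (`pr_expansionFails_le`).

Few gaps. Give each vertex a left copy owning six choices and a right copy owning six others. A
first-moment bound excludes unjoined left and right sets of total size n that both have linear size.
By Hall's theorem there is a permutation that follows arcs of this bipartite graph except at a few
vertices (`exists_perm_of_not_matchingFails`). Its cycles, cut open and concatenated, form the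
ordering: the gaps number at most the bad vertices plus the cycles (`exists_ordering_of_perm`).
There are at most n/L cycles longer than L. Short cycles made of arcs are rare, because the expected
number of arc cycles of a fixed length is polylogarithmic (`pr_card_arcCycle_ge_le`); the other
short cycles contain bad vertices.

Sprinkling. A Pósa rotation never increases the number of gaps, so Pósa's lemma survives for
orderings with at most b gaps (`Expands.card_linked`). Applied at both ends it yields quadratically
many pairs joined by such orderings. An edge on such a pair closes the ordering to a cycle; cutting
at a gap leaves one gap fewer, and without gaps the cycle is Hamiltonian. Some vertex with
unrevealed last choice has at least n/20000 such partners among its predecessors, so revealing that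
choice makes progress with probability at least 1/20000 (`SprinkleState.exists_step`). There are
n/20000 trials and only about n/10^9 successes are needed; an exponential potential (`pr_fail_le`)
makes failure exponentially unlikely. -/

namespace UniformAttachment

/-! ### Orderings of vertices and their gaps -/

open Classical in
/-- The number of pairs of consecutive entries of a list that are not adjacent in `G`. -/
noncomputable def gaps {V : Type*} (G : SimpleGraph V) : List V → ℕ
  | [] => 0
  | [_] => 0
  | a :: b :: l => (if G.Adj a b then 0 else 1) + gaps G (b :: l)

section gaps
variable {V : Type*} (G : SimpleGraph V)

lemma gaps_append_cons (p q : List V) (a : V) :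
    gaps G (p ++ a :: q) = gaps G (p ++ [a]) + gaps G (a :: q) := by
  induction p with
  | nil => simp [gaps]
  | cons x p ih =>
    cases p with
    | nil => simp [gaps]
    | cons y p =>
      simp only [List.cons_append, gaps] at ih ⊢
      omega

lemma gaps_reverse (l : List V) : gaps G l.reverse = gaps G l := by
  induction l with
  | nil => rfl
  | cons a l ih =>
    cases l with
    | nil => rfl
    | cons b l =>
      have h1 : (a :: b :: l).reverse = l.reverse ++ b :: [a] := by simp
      rw [h1, gaps_append_cons]
      have h2 : l.reverse ++ [b] = (b :: l).reverse := by simp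
      rw [h2, ih]
      have h3 : G.Adj b a ↔ G.Adj a b := G.adj_comm b a
      by_cases h : G.Adj a b <;> simp [gaps, h, h3, add_comm]

lemma gaps_append (p q : List V) : gaps G (p ++ q) ≤ gaps G p + gaps G q + 1 := by
  induction p with
  | nil => simp only [List.nil_append]; omega
  | cons x p ih =>
    cases p with
    | nil =>
      cases q with
      | nil => simp [gaps]
      | cons y q => simp only [List.cons_append, List.nil_append, gaps]; split_ifs <;> omega
    | cons y p =>
      simp only [List.cons_append, gaps] at ih ⊢
      omega

variable {G} in
lemma gaps_mono {H : SimpleGraph V} (h : G ≤ H) (l : List V) : gaps H l ≤ gaps G l := by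
  induction l with
  | nil => simp [gaps]
  | cons a l ih =>
    cases l with
    | nil => simp [gaps]
    | cons b l =>
      simp only [gaps]
      have : G.Adj a b → H.Adj a b := fun x => h x
      split_ifs <;> first | omega | tauto

lemma isChain_of_gaps_eq_zero (l : List V) (h : gaps G l = 0) : l.IsChain G.Adj := by
  induction l with
  | nil => simp
  | cons a l ih =>
    cases l with
    | nil => simp
    | cons b l =>
      simp only [gaps] at h
      split_ifs at h with h1
      · simp only [List.isChain_cons_cons]
        exact ⟨h1, ih (by omega)⟩
      · omega

lemma exists_gap_of_gaps_pos (l : List V) (h : 0 < gaps G l) :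
    ∃ p a b q, l = p ++ a :: b :: q ∧ ¬ G.Adj a b := by
  induction l with
  | nil => simp [gaps] at h
  | cons a l ih =>
    cases l with
    | nil => simp [gaps] at h
    | cons b l =>
      by_cases hab : G.Adj a b
      · simp only [gaps, hab, if_true, zero_add] at h
        obtain ⟨p, x, y, q, e, hn⟩ := ih h
        exact ⟨a :: p, x, y, q, by simp [e], hn⟩
      · exact ⟨[], a, b, l, rfl, hab⟩

end gaps

/-! ### Pósa rotations of orderings with gaps -/

section rotation
variable {V : Type*} (G : SimpleGraph V)

/-- `l'` arises from `l` by a Pósa rotation that fixes the head. -/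
def Rotates (l l' : List V) : Prop :=
  ∃ p w q x u, l = p ++ w :: q ∧ q.getLast? = some x ∧ q.head? = some u ∧ G.Adj w x ∧
    l' = p ++ w :: q.reverse

/-- Consecutive entries, in either order. -/
def Consec (l : List V) (a b : V) : Prop :=
  (∃ p q, l = p ++ a :: b :: q) ∨ (∃ p q, l = p ++ b :: a :: q)

variable {G}

lemma Rotates.perm {l l' : List V} (h : Rotates G l l') : l'.Perm l := by
  obtain ⟨p, w, q, x, u, rfl, -, -, -, rfl⟩ := h
  exact List.Perm.append_left _ ((List.reverse_perm q).cons w)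

lemma Rotates.head {l l' : List V} (h : Rotates G l l') : l'.head? = l.head? := by
  obtain ⟨p, w, q, x, u, rfl, -, -, -, rfl⟩ := h
  cases p <;> simp

/-- The rotation trades the pair `w`, `u`, gap or not, for the edge `w`, `x`, and reversing the tail
preserves its gaps. -/
lemma Rotates.gaps_le {l l' : List V} (h : Rotates G l l') : gaps G l' ≤ gaps G l := by
  obtain ⟨p, w, q, x, u, rfl, hx, hu, hw, rfl⟩ := h
  rw [gaps_append_cons, gaps_append_cons G p q w]
  have : gaps G (w :: q.reverse) ≤ gaps G (w :: q) := by
    obtain ⟨q', rfl⟩ : ∃ q', q = q' ++ [x] := by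
      rcases List.eq_nil_or_concat q with rfl | ⟨q', y, rfl⟩
      · simp at hx
      · simp at hx; exact ⟨q', by simp [hx]⟩
    have e : (q' ++ [x]).reverse = x :: q'.reverse := by simp
    have h1 : gaps G (x :: q'.reverse) = gaps G (q' ++ [x]) := by rw [← e, gaps_reverse]
    rw [e, gaps, if_pos hw, h1]
    cases h : q' ++ [x] with
    | nil => simp at h
    | cons y r => simp only [gaps]; omega
  omega

lemma consec_comm {l : List V} {a b : V} : Consec l a b ↔ Consec l b a := or_comm

lemma consec_cons {l : List V} {a b c : V} :
    Consec (c :: l) a b ↔ Consec l a b ∨ (c = a ∧ l.head? = some b) ∨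
      (c = b ∧ l.head? = some a) := by
  unfold Consec
  constructor
  · rintro (⟨p, q, h⟩ | ⟨p, q, h⟩) <;> cases p <;> simp at h
    · obtain ⟨rfl, rfl⟩ := h; simp
    · obtain ⟨rfl, rfl⟩ := h; exact Or.inl (Or.inl ⟨_, _, rfl⟩)
    · obtain ⟨rfl, rfl⟩ := h; simp
    · obtain ⟨rfl, rfl⟩ := h; exact Or.inl (Or.inr ⟨_, _, rfl⟩)
  · rintro ((⟨p, q, h⟩ | ⟨p, q, h⟩) | ⟨rfl, h⟩ | ⟨rfl, h⟩)
    · exact Or.inl ⟨c :: p, q, by simp [h]⟩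
    · exact Or.inr ⟨c :: p, q, by simp [h]⟩
    · cases l with
      | nil => simp at h
      | cons y l => simp at h; subst h; exact Or.inl ⟨[], l, rfl⟩
    · cases l with
      | nil => simp at h
      | cons y l => simp at h; subst h; exact Or.inr ⟨[], l, rfl⟩

lemma consec_append {l m : List V} {a b : V} :
    Consec (l ++ m) a b ↔ Consec l a b ∨ Consec m a b ∨
      (l.getLast? = some a ∧ m.head? = some b) ∨ (l.getLast? = some b ∧ m.head? = some a) := by
  induction l with
  | nil =>
    simp only [List.nil_append, List.getLast?_nil]
    have : ¬ Consec ([] : List V) a b := by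
      rintro (⟨p, q, h⟩ | ⟨p, q, h⟩) <;> cases p <;> simp at h
    simp [this]
  | cons c l ih =>
    rw [List.cons_append, consec_cons, ih, consec_cons]
    cases l with
    | nil =>
      have : ¬ Consec ([] : List V) a b := by
        rintro (⟨p, q, h⟩ | ⟨p, q, h⟩) <;> cases p <;> simp at h
      simp [this]
    | cons d l =>
      simp only [List.cons_append, List.head?_cons, List.getLast?_cons_cons]
      tauto

lemma consec_reverse {l : List V} {a b : V} : Consec l.reverse a b ↔ Consec l a b := by
  induction l with
  | nil => simp
  | cons c l ih =>
    rw [List.reverse_cons, consec_append, ih, consec_cons, consec_cons]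
    have : ¬ Consec ([] : List V) a b := by
      rintro (⟨p, q, h⟩ | ⟨p, q, h⟩) <;> cases p <;> simp at h
    simp [this]
    tauto

/-- The only new consecutive pair after a rotation. -/
lemma Rotates.consec {l l' : List V} (h : Rotates G l l') :
    ∃ w x u, l.getLast? = some x ∧ l'.getLast? = some u ∧ Consec l w u ∧ G.Adj w x ∧
      ∀ a b, Consec l' a b → Consec l a b ∨ (a = w ∧ b = x) ∨ (a = x ∧ b = w) := by
  obtain ⟨p, w, q, x, u, rfl, hx, hu, hw, rfl⟩ := h
  refine ⟨w, x, u, ?_, ?_, ?_, hw, ?_⟩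
  · cases q with
    | nil => simp at hx
    | cons y q => rw [List.getLast?_append_cons, List.getLast?_cons_cons, hx]
  · have : q.reverse.getLast? = some u := by simp [hu]
    cases h : q.reverse with
    | nil => rw [h] at this; simp at this
    | cons y r => rw [List.getLast?_append_cons, List.getLast?_cons_cons, ← h, this]
  · rw [consec_append, consec_cons]; tauto
  · intro a b
    rw [consec_append, consec_append, consec_cons, consec_cons, consec_reverse]
    simp only [List.head?_reverse, hx, List.head?_cons, Option.some.injEq]
    rintro (h | (h | h | h) | h | h)
    · tauto
    · tauto
    · obtain ⟨rfl, rfl⟩ := h; tauto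
    · obtain ⟨rfl, rfl⟩ := h; tauto
    · tauto
    · tauto

/-- The neighbour `w` of the last entry is not itself last, as `G` has no loops; the entry after `w`
becomes the new end. -/
lemma exists_rotates {l : List V} {w x : V} (hx : l.getLast? = some x) (hw : w ∈ l)
    (hadj : G.Adj w x) (hnd : l.Nodup) : ∃ l', Rotates G l l' ∧ 
      ∃ u, l'.getLast? = some u ∧ Consec l w u := by
  obtain ⟨p, q, rfl⟩ := List.append_of_mem hw
  have hq : q ≠ [] := by
    rintro rfl
    simp at hx
    exact G.ne_of_adj hadj hx
  have hx' : q.getLast? = some x := by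
    cases q with
    | nil => simp at hq
    | cons y q => rw [List.getLast?_append_cons, List.getLast?_cons_cons] at hx; exact hx
  obtain ⟨u, hu⟩ : ∃ u, q.head? = some u := by
    cases q with
    | nil => simp at hq
    | cons y q => exact ⟨y, rfl⟩
  refine ⟨_, ⟨p, w, q, x, u, rfl, hx', hu, hadj, rfl⟩, u, ?_, ?_⟩
  · have : q.reverse.getLast? = some u := by simp [hu]
    cases h : q.reverse with
    | nil => rw [h] at this; simp at this
    | cons y r => rw [List.getLast?_append_cons, List.getLast?_cons_cons, ← h, this]
  · rw [consec_append, consec_cons]; tauto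

/-- The vertices consecutive to a set of vertices number at most twice as many. -/
lemma exists_consec_cover [DecidableEq V] {l : List V} (hnd : l.Nodup) (s : Finset V) :
    ∃ t : Finset V, t.card ≤ 2 * s.card ∧ ∀ a ∈ s, ∀ b, Consec l a b → b ∈ t := by
  -- At either end of `l` the default value or the truncated subtraction returns the vertex itself,
  -- which is harmless in a cover.
  refine ⟨s.image (fun v => l.getD (l.idxOf v + 1) v) ∪
    s.image (fun v => l.getD (l.idxOf v - 1) v), ?_, ?_⟩
  · refine (Finset.card_union_le _ _).trans ?_
    have := Finset.card_image_le (s := s) (f := fun v => l.getD (l.idxOf v + 1) v)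
    have := Finset.card_image_le (s := s) (f := fun v => l.getD (l.idxOf v - 1) v)
    omega
  · rintro a ha b (⟨p, q, rfl⟩ | ⟨p, q, rfl⟩)
    · apply Finset.mem_union_left
      refine Finset.mem_image.2 ⟨a, ha, ?_⟩
      have hap : a ∉ p := by
        intro h
        have := (List.nodup_append.1 hnd).2.2 a h a (by simp)
        exact this rfl
      simp [List.idxOf_append, hap]
    · apply Finset.mem_union_right
      refine Finset.mem_image.2 ⟨a, ha, ?_⟩
      have hap : a ∉ p := by
        intro h
        have := (List.nodup_append.1 hnd).2.2 a h a (by simp)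
        exact this rfl
      have hab : b ≠ a := by
        rintro rfl
        have := (List.nodup_append.1 hnd).2.1
        simp at this
      simp [List.idxOf_append, hap, hab]

end rotation

/-! ### Pósa's lemma, and closing an ordering -/

section posa
variable {V : Type*} (G : SimpleGraph V)

/-- Every nonempty set of at most `a` vertices, together with its neighbours, is more than three
times as large as the set. -/
def Expands (a : ℕ) : Prop :=
  ∀ s w : Finset V, s.Nonempty → s.card ≤ a → s ⊆ w → (∀ u ∈ s, ∀ v, G.Adj u v → v ∈ w) →
    3 * s.card < w.card

/-- An ordering of all the vertices. -/
def IsOrdering (l : List V) : Prop := l.Nodup ∧ ∀ v, v ∈ l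

/-- There is an ordering of all the vertices from `x` to `y` with at most `b` gaps. -/
def Linked (b : ℕ) (x y : V) : Prop :=
  ∃ l, IsOrdering l ∧ gaps G l ≤ b ∧ l.head? = some x ∧ l.getLast? = some y

variable {G}

lemma Expands.mono {H : SimpleGraph V} (h : G ≤ H) {a : ℕ} (hG : Expands G a) : Expands H a :=
  fun s w h1 h2 h3 h4 => hG s w h1 h2 h3 fun u hu v huv => h4 u hu v (h huv)

lemma Linked.symm {b : ℕ} {x y : V} (h : Linked G b x y) : Linked G b y x := by
  obtain ⟨l, ⟨h1, h2⟩, h3, h4, h5⟩ := h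
  exact ⟨l.reverse, ⟨by simpa using h1, by simpa using h2⟩, by rwa [gaps_reverse],
    by simpa using h5, by simpa using h4⟩

open Classical in
/-- Closing an ordering by an edge between its ends and cutting it open at a gap. -/
lemma Linked.close {b : ℕ} {x y : V} (h : Linked G (b + 1) x y) (hxy : G.Adj x y) :
    ∃ l : List V, IsOrdering l ∧ gaps G l ≤ b := by
  obtain ⟨l, ho, hb, hx, hy⟩ := h
  rcases Nat.eq_zero_or_pos (gaps G l) with h0 | hpos
  · exact ⟨l, ho, by omega⟩
  obtain ⟨p, c, d, q, rfl, hcd⟩ := exists_gap_of_gaps_pos G l hpos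
  have hperm : (d :: q ++ (p ++ [c])).Perm (p ++ c :: d :: q) := by
    have : p ++ c :: d :: q = (p ++ [c]) ++ (d :: q) := by simp
    rw [this]
    exact List.perm_append_comm
  refine ⟨d :: q ++ (p ++ [c]), ⟨hperm.nodup_iff.2 ho.1, fun v => hperm.mem_iff.2 (ho.2 v)⟩, ?_⟩
  obtain ⟨r, hr⟩ : ∃ r, d :: q = r ++ [y] := by
    rw [List.getLast?_append_cons, List.getLast?_cons_cons] at hy
    rcases List.eq_nil_or_concat (d :: q) with h | ⟨r, z, h⟩
    · simp at h
    · rw [h] at hy; simp at hy; exact ⟨r, by simp [h, hy]⟩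
  obtain ⟨r', hr'⟩ : ∃ r', p ++ [c] = x :: r' := by
    cases p with
    | nil => simp at hx; exact ⟨[], by simp [hx]⟩
    | cons z p => simp at hx; exact ⟨p ++ [c], by simp [hx]⟩
  have e1 : gaps G (p ++ c :: d :: q) = gaps G (p ++ [c]) + 1 + gaps G (d :: q) := by
    rw [gaps_append_cons]; simp [gaps, hcd]; omega
  have e2 : gaps G (d :: q ++ (p ++ [c])) = gaps G (p ++ [c]) + gaps G (d :: q) := by
    rw [hr, hr']
    rw [List.append_assoc, List.singleton_append, gaps_append_cons]
    simp [gaps, hxy.symm]; omega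
  omega

variable [Fintype V] [DecidableEq V]

open Classical in
/-- Pósa's lemma. -/
lemma Expands.card_linked {a b : ℕ} (hG : Expands G a) {x y : V} (h : Linked G b x y) :
    a < (Finset.univ.filter fun z => Linked G b x z).card := by
  obtain ⟨l₀, ho, hb, hx, hy⟩ := h
  -- `S` is the set of ends reachable by rotations. If it had at most `a` elements, its closed
  -- neighbourhood would lie in `S` together with the at most `2|S|` vertices consecutive to `S` in
  -- `l₀`, contrary to expansion.
  let S : Finset V := Finset.univ.filter fun z =>
    ∃ l, Relation.ReflTransGen (Rotates G) l₀ l ∧ l.getLast? = some z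
  have hperm : ∀ l, Relation.ReflTransGen (Rotates G) l₀ l →
      l.Perm l₀ ∧ gaps G l ≤ b ∧ l.head? = some x := by
    intro l hl
    induction hl with
    | refl => exact ⟨List.Perm.refl _, hb, hx⟩
    | tail _ hr ih =>
      exact ⟨hr.perm.trans ih.1, hr.gaps_le.trans ih.2.1, hr.head.trans ih.2.2⟩
  have hord : ∀ l, l.Perm l₀ → IsOrdering l := fun l hl =>
    ⟨hl.nodup_iff.2 ho.1, fun v => hl.mem_iff.2 (ho.2 v)⟩
  have hSsub : S ⊆ Finset.univ.filter fun z => Linked G b x z := by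
    intro z hz
    obtain ⟨l, hl, hz⟩ := (Finset.mem_filter.1 hz).2
    obtain ⟨h1, h2, h3⟩ := hperm l hl
    exact Finset.mem_filter.2 ⟨Finset.mem_univ _, l, hord l h1, h2, h3, hz⟩
  refine lt_of_lt_of_le ?_ (Finset.card_le_card hSsub)
  by_contra hlt
  push Not at hlt
  have hyS : y ∈ S := Finset.mem_filter.2 ⟨Finset.mem_univ _, l₀, .refl, hy⟩
  obtain ⟨t, ht, hcov⟩ := exists_consec_cover ho.1 S
  -- Away from `S ∪ t` rotations never create a pair: the new pair consists of an old end, in `S`,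
  -- and the pivot `w`, which was consecutive to a new end and hence lies in `S ∪ t` by induction.
  have key : ∀ l, Relation.ReflTransGen (Rotates G) l₀ l →
      ∀ c d, Consec l c d → (c ∉ S ∪ t ∨ d ∉ S ∪ t) → Consec l₀ c d := by
    intro l hl
    induction hl with
    | refl => intro c d h _; exact h
    | @tail l l' hl hr ih =>
      intro c d hcd hnot
      obtain ⟨w, z, u, hz, hu, hwu, hwz, hnew⟩ := hr.consec
      have hzS : z ∈ S := Finset.mem_filter.2 ⟨Finset.mem_univ _, l, hl, hz⟩
      have huS : u ∈ S := Finset.mem_filter.2 ⟨Finset.mem_univ _, l', hl.tail hr, hu⟩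
      have hwX : w ∈ S ∪ t := by
        by_contra hw
        have := ih w u hwu (Or.inl hw)
        exact hw (Finset.mem_union_right _ (hcov u huS w (consec_comm.1 this)))
      rcases hnew c d hcd with h | ⟨rfl, rfl⟩ | ⟨rfl, rfl⟩
      · exact ih c d h hnot
      · rcases hnot with h | h
        · exact absurd hwX h
        · exact absurd (Finset.mem_union_left _ hzS) h
      · rcases hnot with h | h
        · exact absurd (Finset.mem_union_left _ hzS) h
        · exact absurd hwX h
  -- A neighbour `w` of an end permits a rotation whose new end `u` is consecutive to `w`. Were `w`
  -- outside `S ∪ t`, this pair would already occur in `l₀`, putting `w` in `t`.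
  have hexp := hG S (S ∪ t) ⟨y, hyS⟩ hlt Finset.subset_union_left (by
    intro z hz w hzw
    obtain ⟨l, hl, hzl⟩ := (Finset.mem_filter.1 hz).2
    have hol := hord l (hperm l hl).1
    obtain ⟨l', hr, u, hu, hwu⟩ := exists_rotates hzl (hol.2 w) hzw.symm hol.1
    have huS : u ∈ S := Finset.mem_filter.2 ⟨Finset.mem_univ _, l', hl.tail hr, hu⟩
    by_contra hw
    have := key l hl w u hwu (Or.inl hw)
    exact hw (Finset.mem_union_right _ (hcov u huS w (consec_comm.1 this))))
  have := Finset.card_union_le S t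
  omega

/-- Three vertices are needed so that the closing edge is not already on the path: a path containing
an edge between its ends has length one. -/
lemma IsOrdering.isHamiltonian {l : List V} (hl : IsOrdering l) (h3 : 3 ≤ Fintype.card V)
    (hg : gaps G l = 0) {x y : V} (hx : l.head? = some x) (hy : l.getLast? = some y)
    (hxy : G.Adj y x) : G.IsHamiltonian := by
  intro _
  have hne : l ≠ [] := by rintro rfl; simp at hx
  obtain rfl : l.head hne = x := by rw [List.head?_eq_some_head hne] at hx; simpa using hx
  obtain rfl : l.getLast hne = y := by rw [List.getLast?_eq_some_getLast hne] at hy; simpa using hy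
  let p := SimpleGraph.Walk.ofSupport l hne (isChain_of_gaps_eq_zero G l hg)
  have hsupp : p.support = l := SimpleGraph.Walk.support_ofSupport _ _
  have hp : p.IsPath := by rw [SimpleGraph.Walk.isPath_def, hsupp]; exact hl.1
  have hlen : l.length = Fintype.card V := by
    rw [← List.toFinset_card_of_nodup hl.1, ← Finset.card_univ]
    congr 1
    ext v
    simp [hl.2 v]
  have hplen : p.length = l.length - 1 := SimpleGraph.Walk.length_ofSupport _ _
  refine ⟨_, .cons hxy p, SimpleGraph.Walk.isHamiltonianCycle_iff_isCycle_and_length_eq.2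
    ⟨(SimpleGraph.Walk.cons_isCycle_iff _ _).2 ⟨hp, fun h => ?_⟩, ?_⟩⟩
  · rw [Sym2.eq_swap] at h
    have := hp.length_eq_one_of_mem_edges h
    omega
  · rw [SimpleGraph.Walk.length_cons]
    omega

end posa

end UniformAttachment

namespace UniformAttachment

/-! ### From a permutation to an ordering with few gaps -/

section permutation
open Classical Function
variable {V : Type*} (G : SimpleGraph V) {r : V → V → Prop} (π : Equiv.Perm V)

lemma minimalPeriod_perm_pos [Finite V] (x : V) : 0 < minimalPeriod π x := by
  have h := isOfFinOrder_of_finite π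
  obtain ⟨m, hm, h⟩ := isOfFinOrder_iff_pow_eq_one.1 h
  refine IsPeriodicPt.minimalPeriod_pos (n := m) hm ?_
  rw [IsPeriodicPt, IsFixedPt, ← Equiv.Perm.coe_pow, h]
  rfl

lemma gaps_iterate_le (hr : ∀ u v, r u v → G.Adj u v) (x : V) (m : ℕ) :
    gaps G (List.iterate π x m) ≤ (List.iterate π x m).countP (fun v => ¬ r v (π v)) := by
  induction m generalizing x with
  | zero => simp [gaps]
  | succ m ih =>
    cases m with
    | zero => simp [gaps]
    | succ m =>
      have := ih (π x)
      simp only [List.iterate, gaps] at this ⊢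
      rw [List.countP_cons]
      by_cases h : r x (π x)
      · simp [h, hr _ _ h] at this ⊢; omega
      · simp [h] at this ⊢; split_ifs <;> omega

lemma nodup_iterate_minimalPeriod (x : V) : (List.iterate π x (minimalPeriod π x)).Nodup := by
  rw [← List.range_map_iterate]
  refine List.Nodup.map_on ?_ List.nodup_range
  intro i hi j hj h
  exact iterate_injOn_Iio_minimalPeriod (List.mem_range.1 hi) (List.mem_range.1 hj) h

/-- Each cycle gets total weight one, so summing reciprocal periods counts cycles. -/
lemma sum_inv_minimalPeriod [Finite V] (x : V) :
    ∑ v ∈ (List.iterate π x (minimalPeriod π x)).toFinset, (1 : ℝ) / minimalPeriod π v = 1 := by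
  have hp := minimalPeriod_perm_pos π x
  have h : ∀ v ∈ (List.iterate π x (minimalPeriod π x)).toFinset,
      (1 : ℝ) / minimalPeriod π v = 1 / minimalPeriod π x := by
    intro v hv
    obtain ⟨i, -, rfl⟩ := List.mem_iterate.1 (List.mem_toFinset.1 hv)
    rw [minimalPeriod_apply_iterate (minimalPeriod_pos_iff_mem_periodicPts.1 hp)]
  rw [Finset.sum_congr rfl h, Finset.sum_const,
    List.toFinset_card_of_nodup (nodup_iterate_minimalPeriod π x), List.length_iterate,
    nsmul_eq_mul]
  field_simp

/-- Whole orbits are removed one by one; `k` counts them, and each costs at most one gap where the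
lists are joined. The relation `r` may be finer than adjacency: it will be the oriented arc
relation, whose short cycles can be counted. -/
lemma exists_list_of_perm [Finite V] (hr : ∀ u v, r u v → G.Adj u v) (A : Finset V) (hA : ∀ v ∈ A, π v ∈ A) :
    ∃ (l : List V) (k : ℕ), l.Nodup ∧ (∀ v, v ∈ l ↔ v ∈ A) ∧
      gaps G l ≤ l.countP (fun v => ¬ r v (π v)) + k ∧
      (k : ℝ) = ∑ v ∈ A, (1 : ℝ) / minimalPeriod π v := by
  induction hn : A.card using Nat.strong_induction_on generalizing A with
  | _ n ih =>
  rcases A.eq_empty_or_nonempty with rfl | ⟨x, hx⟩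
  · exact ⟨[], 0, by simp, by simp, by simp [gaps], by simp⟩
  have hp := minimalPeriod_perm_pos π x
  set O := List.iterate π x (minimalPeriod π x) with hO
  have hmem : ∀ v, v ∈ O ↔ ∃ i, π^[i] x = v := by
    intro v
    rw [hO, List.mem_iterate]
    constructor
    · rintro ⟨i, -, rfl⟩; exact ⟨i, rfl⟩
    · rintro ⟨i, rfl⟩
      exact ⟨i % minimalPeriod π x, Nat.mod_lt _ hp, iterate_mod_minimalPeriod_eq.symm⟩
  have hOA : O.toFinset ⊆ A := by
    intro v hv
    obtain ⟨i, rfl⟩ := (hmem v).1 (List.mem_toFinset.1 hv)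
    clear hv
    induction i with
    | zero => exact hx
    | succ i ih => rw [iterate_succ_apply']; exact hA _ ih
  have hxO : x ∈ O.toFinset := List.mem_toFinset.2 ((hmem x).2 ⟨0, rfl⟩)
  obtain ⟨l, k, h1, h2, h3, h4⟩ := ih (A \ O.toFinset).card
    (by
      rw [← hn]
      exact Finset.card_lt_card (Finset.sdiff_ssubset hOA ⟨x, hxO⟩))
    (A \ O.toFinset) (by
      intro v hv
      rw [Finset.mem_sdiff] at hv ⊢
      refine ⟨hA v hv.1, fun h => hv.2 ?_⟩
      obtain ⟨i, hi⟩ := (hmem _).1 (List.mem_toFinset.1 h)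
      -- Period minus one further steps lead from `π v` back to `v`.
      refine List.mem_toFinset.2 ((hmem v).2 ⟨i + (minimalPeriod π x - 1), ?_⟩)
      apply π.injective
      rw [← hi, ← iterate_succ_apply' π, ← iterate_add_minimalPeriod_eq (n := i)]
      congr 1
      omega) rfl
  refine ⟨O ++ l, k + 1, ?_, ?_, ?_, ?_⟩
  · refine List.nodup_append.2 ⟨nodup_iterate_minimalPeriod π x, h1, ?_⟩
    rintro a ha b hb rfl
    have := (h2 a).1 hb
    rw [Finset.mem_sdiff] at this
    exact this.2 (List.mem_toFinset.2 ha)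
  · intro v
    rw [List.mem_append, h2, Finset.mem_sdiff, List.mem_toFinset]
    have : v ∈ O → v ∈ A := fun h => hOA (List.mem_toFinset.2 h)
    tauto
  · have := gaps_append G O l
    have := gaps_iterate_le G π hr x (minimalPeriod π x)
    rw [← hO] at this
    rw [List.countP_append]
    omega
  · rw [← Finset.sum_sdiff hOA, sum_inv_minimalPeriod, ← h4]
    push_cast; ring

/-- A permutation that mostly moves along edges and has few short cycles along edges yields an
ordering with few gaps. -/
lemma exists_ordering_of_perm [Fintype V] (hr : ∀ u v, r u v → G.Adj u v) {L : ℕ}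
    (hL : 0 < L) :
    ∃ l : List V, IsOrdering l ∧
      (gaps G l : ℝ) ≤ (L + 1) * (Finset.univ.filter fun v => ¬ r v (π v)).card +
        (Finset.univ.filter fun v => minimalPeriod π v ≤ L ∧
          ∀ i, r (π^[i] v) (π (π^[i] v))).card + Fintype.card V / L := by
  obtain ⟨l, k, h1, h2, h3, h4⟩ := exists_list_of_perm G π hr Finset.univ (by simp)
  refine ⟨l, ⟨h1, by simpa using h2⟩, ?_⟩
  set B := Finset.univ.filter fun v => ¬ r v (π v) with hB
  set Y := Finset.univ.filter fun v => minimalPeriod π v ≤ L ∧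
          ∀ i, r (π^[i] v) (π (π^[i] v)) with hY
  have hcount : l.countP (fun v => ¬ r v (π v)) = B.card := by
    rw [List.countP_eq_length_filter, ← List.toFinset_card_of_nodup (h1.filter _)]
    congr 1
    ext v
    simp [h2, hB]
  set P := Finset.univ.filter fun v => minimalPeriod π v ≤ L with hP
  -- A vertex of period at most `L` whose cycle contains a bad vertex is one of the first `L`
  -- iterates of that bad vertex.
  have hPcard : P.card ≤ Y.card + L * B.card := by
    have hsub : P ⊆ Y ∪ (Finset.range L).biUnion fun i => B.image (π^[i]) := by
      intro v hv
      by_cases hg : ∀ i, r (π^[i] v) (π (π^[i] v))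
      · exact Finset.mem_union_left _ (by
          simp only [hY, Finset.mem_filter, Finset.mem_univ, true_and]
          exact ⟨(Finset.mem_filter.1 hv).2, hg⟩)
      · apply Finset.mem_union_right
        push Not at hg
        obtain ⟨i, hi⟩ := hg
        have hp := minimalPeriod_perm_pos π v
        have hvL : minimalPeriod π v ≤ L := (Finset.mem_filter.1 hv).2
        set m := minimalPeriod π v with hm
        have hmod := Nat.mod_lt i hp
        rcases Nat.eq_zero_or_pos (i % m) with h0 | h0
        · refine Finset.mem_biUnion.2 ⟨0, Finset.mem_range.2 hL, Finset.mem_image.2 ⟨v, ?_, rfl⟩⟩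
          rw [← iterate_mod_minimalPeriod_eq, ← hm, h0] at hi
          simpa [hB] using hi
        · refine Finset.mem_biUnion.2 ⟨m - i % m, Finset.mem_range.2 (by omega),
            Finset.mem_image.2 ⟨π^[i] v, by simpa [hB] using hi, ?_⟩⟩
          rw [← iterate_mod_minimalPeriod_eq (n := i), ← hm, ← iterate_add_apply,
            Nat.sub_add_cancel hmod.le, hm, iterate_minimalPeriod]
    refine (Finset.card_le_card hsub).trans ((Finset.card_union_le _ _).trans ?_)
    have : ((Finset.range L).biUnion fun i => B.image (π^[i])).card ≤ (Finset.range L).card * B.card :=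
      Finset.card_biUnion_le_card_mul _ _ _ fun i _ => Finset.card_image_le
    rw [Finset.card_range] at this
    omega
  have hk : (k : ℝ) ≤ P.card + Fintype.card V / L := by
    rw [h4]
    have hterm : ∀ v : V, (1 : ℝ) / minimalPeriod π v ≤ (if minimalPeriod π v ≤ L then 1 else 0) + 1 / L := by
      intro v
      have hp : (1 : ℝ) ≤ minimalPeriod π v := by exact_mod_cast minimalPeriod_perm_pos π v
      split_ifs with h
      · have : (1 : ℝ) / minimalPeriod π v ≤ 1 := by rw [div_le_one (by linarith)]; exact hp
        have : (0 : ℝ) ≤ 1 / L := by positivity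
        linarith
      · rw [zero_add]
        apply one_div_le_one_div_of_le (by exact_mod_cast hL)
        exact_mod_cast (not_le.1 h).le
    refine (Finset.sum_le_sum fun v _ => hterm v).trans ?_
    rw [Finset.sum_add_distrib, Finset.sum_const, Finset.sum_boole, Finset.card_univ, nsmul_eq_mul]
    rw [mul_one_div]
  rw [hcount] at h3
  have h3' : (gaps G l : ℝ) ≤ B.card + k := by exact_mod_cast h3
  have h5 : (P.card : ℝ) ≤ Y.card + L * B.card := by exact_mod_cast hPcard
  linarith

end permutation

end UniformAttachment

namespace UniformAttachment

/-! ### Probability as a proportion of outcomes -/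

section counting
open Classical

/-- The proportion of the outcomes that satisfy `P`. -/
noncomputable def pr {Ω : Type*} [Fintype Ω] (P : Ω → Prop) : ℝ :=
  (Finset.univ.filter P).card / Fintype.card Ω

variable {Ω : Type*} [Fintype Ω]

lemma pr_eq (P : Ω → Prop) [DecidablePred P] :
    pr P = ((Finset.univ.filter P).card : ℝ) / Fintype.card Ω := by
  unfold pr; congr

lemma pr_nonneg (P : Ω → Prop) : 0 ≤ pr P := by unfold pr; positivity

lemma pr_mono {P Q : Ω → Prop} (h : ∀ c, P c → Q c) : pr P ≤ pr Q := by
  unfold pr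
  gcongr with c
  exact h c

lemma pr_or_le (P Q : Ω → Prop) : pr (fun c => P c ∨ Q c) ≤ pr P + pr Q := by
  rw [pr_eq, pr_eq P, pr_eq Q, ← add_div]
  gcongr
  rw [Finset.filter_or]
  exact_mod_cast Finset.card_union_le _ _

lemma pr_exists_le {I : Type*} (s : Finset I) (P : I → Ω → Prop) :
    pr (fun c => ∃ i ∈ s, P i c) ≤ ∑ i ∈ s, pr (P i) := by
  simp only [pr_eq]
  rw [← Finset.sum_div]
  gcongr
  have : (Finset.univ.filter fun c => ∃ i ∈ s, P i c) ⊆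
      s.biUnion fun i => Finset.univ.filter (P i) := by
    intro c hc
    simpa using hc
  rw [← Nat.cast_sum, Nat.cast_le]
  exact (Finset.card_le_card this).trans Finset.card_biUnion_le

lemma pr_not [Nonempty Ω] (P : Ω → Prop) : pr P = 1 - pr (fun c => ¬ P c) := by
  rw [pr_eq P, pr_eq]
  have h := Finset.card_filter_add_card_filter_not (s := (Finset.univ : Finset Ω)) P
  have h0 : (Fintype.card Ω : ℝ) ≠ 0 := by exact_mod_cast Fintype.card_ne_zero
  have h' : ((Finset.univ.filter P).card : ℝ) + (Finset.univ.filter fun c => ¬ P c).card =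
      Fintype.card Ω := by exact_mod_cast h
  rw [eq_sub_iff_add_eq, ← add_div, h', div_self h0]

/-- Markov's inequality for the number of events that occur. -/
lemma pr_le_card_filter {I : Type*} (s : Finset I) (P : I → Ω → Prop) {a : ℝ} (ha : 0 < a) :
    pr (fun c => a ≤ (s.filter fun i => P i c).card) ≤ (∑ i ∈ s, pr (P i)) / a := by
  rw [le_div_iff₀ ha]
  unfold pr
  rw [← Finset.sum_div, div_mul_eq_mul_div]
  gcongr
  have h1 : ∑ i ∈ s, ((Finset.univ.filter (P i)).card : ℝ) =
      ∑ c : Ω, ((s.filter fun i => P i c).card : ℝ) := by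
    simp only [Finset.card_filter, Nat.cast_sum]
    rw [Finset.sum_comm]
  rw [h1, ← nsmul_eq_mul, ← Finset.sum_const]
  refine (Finset.sum_le_sum fun c hc => (Finset.mem_filter.1 hc).2).trans ?_
  exact Finset.sum_le_sum_of_subset_of_nonneg (Finset.subset_univ _) fun _ _ _ => by positivity

end counting

/-! ### Adaptive exposure of independent coordinates -/

section product
variable {ι : Type*} [Fintype ι] [DecidableEq ι] {β : ι → Type*} [∀ p, Fintype (β p)]

lemma pr_pi (A : ∀ p, Finset (β p)) :
    pr (fun c : ∀ p, β p => ∀ p, c p ∈ A p) = ∏ p, ((A p).card : ℝ) / Fintype.card (β p) := by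
  unfold pr
  rw [Finset.prod_div_distrib, Fintype.card_pi, Nat.cast_prod]
  congr 1
  rw [← Nat.cast_prod, ← Fintype.card_piFinset]
  congr 2
  ext c
  simp

lemma card_cylinder (D : Finset ι) (c : ∀ p, β p) [DecidablePred fun c' : ∀ p, β p => ∀ p ∈ D, c' p = c p] :
    (Finset.univ.filter fun c' : ∀ p, β p => ∀ p ∈ D, c' p = c p).card =
      ∏ p ∈ Dᶜ, Fintype.card (β p) := by
  classical
  have : (Finset.univ.filter fun c' : ∀ p, β p => ∀ p ∈ D, c' p = c p) =
      Fintype.piFinset fun p => if p ∈ D then {c p} else Finset.univ := by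
    ext c'
    simp only [Finset.mem_filter, Finset.mem_univ, true_and, Fintype.mem_piFinset]
    refine forall_congr' fun p => ?_
    by_cases h : p ∈ D <;> simp [h]
  rw [this, Fintype.card_piFinset]
  rw [← Finset.prod_compl_mul_prod D]
  rw [Finset.prod_congr rfl (g := fun p => Fintype.card (β p)) (s₁ := Dᶜ)]
  · rw [Finset.prod_eq_one (s := D), mul_one]
    intro p hp
    simp [hp]
  · intro p hp
    rw [Finset.mem_compl] at hp
    simp [hp]

variable (State : Finset ι → (∀ p, β p) → ℕ → Prop) (Fail : (∀ p, β p) → Prop) (θ : ℝ) (N : ℕ)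

open Classical in
/-- Exposing the coordinates one at a time, each time choosing a coordinate that decreases the
state with probability at least `θ`. -/
lemma card_fail_le (hθ : θ ≤ 2)
    (hdep : ∀ D c c' m, (∀ p ∈ D, c' p = c p) → State D c m → State D c' m)
    (hzero : ∀ D c, State D c 0 → ¬ Fail c)
    (hstep : ∀ D c m, D.card < N → State D c (m + 1) → ∃ p ∉ D,
      (∀ v, State (insert p D) (Function.update c p v) (m + 1)) ∧
      θ * Fintype.card (β p) ≤
        (Finset.univ.filter fun v => State (insert p D) (Function.update c p v) m).card)
    (t : ℕ) : ∀ m D c, State D c m → D.card + t ≤ N →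
      ((Finset.univ.filter fun c' => Fail c' ∧ ∀ p ∈ D, c' p = c p).card : ℝ) ≤
        2 ^ m * (1 - θ / 2) ^ t * ((∏ p ∈ Dᶜ, Fintype.card (β p) : ℕ) : ℝ) := by
  have hl : 0 ≤ 1 - θ / 2 := by linarith
  have hz : ∀ t D c, State D c 0 →
      ((Finset.univ.filter fun c' => Fail c' ∧ ∀ p ∈ D, c' p = c p).card : ℝ) ≤
        2 ^ 0 * (1 - θ / 2) ^ t * ((∏ p ∈ Dᶜ, Fintype.card (β p) : ℕ) : ℝ) := by
    intro t D c h
    rw [Finset.card_eq_zero.2]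
    · rw [Nat.cast_zero]; positivity
    · rw [Finset.filter_eq_empty_iff]
      rintro c' - ⟨hf, hc⟩
      exact hzero D c' (hdep D c c' 0 hc h) hf
  induction t with
  | zero =>
    intro m D c _ _
    rw [← card_cylinder D c, pow_zero, mul_one]
    have h1 : ((Finset.univ.filter fun c' => Fail c' ∧ ∀ p ∈ D, c' p = c p).card : ℝ) ≤
        (Finset.univ.filter fun c' : ∀ p, β p => ∀ p ∈ D, c' p = c p).card := by
      gcongr
      tauto
    refine h1.trans (le_mul_of_one_le_left (by positivity) ?_)
    exact one_le_pow₀ (by norm_num)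
  | succ t ih =>
    intro m D c hs hN
    cases m with
    | zero => exact hz (t + 1) D c hs
    | succ m =>
      obtain ⟨p, hp, h1, h2⟩ := hstep D c m (by omega) hs
      have hcard : (insert p D).card + t ≤ N := by
        rw [Finset.card_insert_of_notMem hp]; omega
      set B := Finset.univ.filter fun v => State (insert p D) (Function.update c p v) m
      have hcompl : Dᶜ = insert p (insert p D)ᶜ := by
        ext q
        by_cases h : q = p <;> simp [h, hp]
      have hprod : (∏ q ∈ Dᶜ, Fintype.card (β q)) =
          Fintype.card (β p) * ∏ q ∈ (insert p D)ᶜ, Fintype.card (β q) := by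
        rw [hcompl, Finset.prod_insert (by simp)]
      set κ : ℝ := ((∏ q ∈ (insert p D)ᶜ, Fintype.card (β q) : ℕ) : ℝ) with hκ
      have hκ0 : 0 ≤ κ := by positivity
      have hsplit : (Finset.univ.filter fun c' => Fail c' ∧ ∀ q ∈ D, c' q = c q).card =
          ∑ v : β p, (Finset.univ.filter fun c' => Fail c' ∧
            ∀ q ∈ insert p D, c' q = Function.update c p v q).card := by
        rw [Finset.card_eq_sum_card_fiberwise (f := fun c' => c' p) (t := Finset.univ)
          (fun _ _ => Finset.mem_coe.2 (Finset.mem_univ _))]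
        refine Finset.sum_congr rfl fun v _ => ?_
        congr 1
        ext c'
        simp only [Finset.mem_filter, Finset.mem_univ, true_and, Finset.forall_mem_insert,
          Function.update_self]
        have : (∀ q ∈ D, c' q = Function.update c p v q) ↔ ∀ q ∈ D, c' q = c q := by
          refine forall₂_congr fun q hq => ?_
          rw [Function.update_of_ne]
          rintro rfl
          exact hp hq
        rw [this]
        tauto
      rw [hsplit, Nat.cast_sum]
      set ρ := (1 - θ / 2) ^ t with hlt
      have hlt0 : 0 ≤ ρ := by positivity
      -- The potential `2 ^ state` halves on the values in `B`, a proportion of at least `θ`, and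
      -- does not grow on the others. Averaging over `v` gains the factor `1 - θ / 2`.
      have hterm : ∀ v : β p, ((Finset.univ.filter fun c' => Fail c' ∧
            ∀ q ∈ insert p D, c' q = Function.update c p v q).card : ℝ) ≤
          2 ^ m * ρ * κ * (2 - if v ∈ B then 1 else 0) := by
        intro v
        split_ifs with hv
        · refine (ih m _ _ (Finset.mem_filter.1 hv).2 hcard).trans (le_of_eq ?_)
          ring
        · refine (ih (m + 1) _ _ (h1 v) hcard).trans (le_of_eq ?_)
          ring
      refine (Finset.sum_le_sum fun v _ => hterm v).trans ?_
      rw [← Finset.mul_sum, Finset.sum_sub_distrib, Finset.sum_const, Finset.sum_boole,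
        Finset.card_univ, Finset.filter_mem_eq_inter, Finset.univ_inter, hprod, nsmul_eq_mul,
        Nat.cast_mul, ← hκ, pow_succ (1 - θ / 2) t, ← hlt]
      have : 2 ^ m * ρ * κ * (Fintype.card (β p) * 2 - (B.card : ℝ)) ≤
          2 ^ m * ρ * κ * (Fintype.card (β p) * 2 - θ * Fintype.card (β p)) := by
        gcongr
      refine this.trans (le_of_eq ?_)
      ring

open Classical in
-- The outcomes satisfying `State D c m` form a union of cylinders over `D`. Counting pairs of
-- outcomes that agree on `D` averages the cylinder bound `card_fail_le`.
lemma pr_fail_le [∀ p, Nonempty (β p)] (hθ : θ ≤ 2)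
    (hdep : ∀ D c c' m, (∀ p ∈ D, c' p = c p) → State D c m → State D c' m)
    (hzero : ∀ D c, State D c 0 → ¬ Fail c)
    (hstep : ∀ D c m, D.card < N → State D c (m + 1) → ∃ p ∉ D,
      (∀ v, State (insert p D) (Function.update c p v) (m + 1)) ∧
      θ * Fintype.card (β p) ≤
        (Finset.univ.filter fun v => State (insert p D) (Function.update c p v) m).card)
    (t m : ℕ) (D : Finset ι) (hN : D.card + t ≤ N) :
    pr (fun c => State D c m ∧ Fail c) ≤ 2 ^ m * (1 - θ / 2) ^ t := by
  have hl : 0 ≤ 1 - θ / 2 := by linarith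
  rw [pr_eq, div_le_iff₀ (by exact_mod_cast Fintype.card_pos)]
  set κ := ∏ p ∈ Dᶜ, Fintype.card (β p) with hκ
  have hκ0 : (0 : ℝ) < κ := by
    rw [hκ]; exact_mod_cast Finset.prod_pos fun p _ => Fintype.card_pos
  have key : (κ : ℝ) * (Finset.univ.filter fun c => State D c m ∧ Fail c).card ≤
      ∑ c ∈ Finset.univ.filter fun c => State D c m,
        ((Finset.univ.filter fun c' => Fail c' ∧ ∀ p ∈ D, c' p = c p).card : ℝ) := by
    have h1 : ∀ c, State D c m → (Finset.univ.filter fun c' => Fail c' ∧ ∀ p ∈ D, c' p = c p) =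
        ((Finset.univ.filter fun c => State D c m ∧ Fail c).filter
          fun c' => ∀ p ∈ D, c' p = c p) := by
      intro c hc
      ext c'
      simp only [Finset.mem_filter, Finset.mem_univ, true_and]
      have := hdep D c c' m
      tauto
    rw [Finset.sum_congr rfl fun c hc => by rw [h1 c (Finset.mem_filter.1 hc).2]]
    simp only [Finset.card_filter _ (Finset.filter _ _), Nat.cast_sum]
    rw [Finset.sum_comm, mul_comm, ← nsmul_eq_mul, ← Finset.sum_const]
    refine Finset.sum_le_sum fun c hc => ?_
    rw [← Nat.cast_sum, ← Finset.card_filter]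
    norm_cast
    rw [hκ, ← card_cylinder D c]
    refine Finset.card_le_card fun c' hc' => ?_
    simp only [Finset.mem_filter, Finset.mem_univ, true_and] at hc' hc ⊢
    exact ⟨hdep D c c' m hc' hc.1, fun p hp => (hc' p hp).symm⟩
  have h2 : ∑ c ∈ Finset.univ.filter fun c => State D c m,
        ((Finset.univ.filter fun c' => Fail c' ∧ ∀ p ∈ D, c' p = c p).card : ℝ) ≤
      Fintype.card (∀ p, β p) * (2 ^ m * (1 - θ / 2) ^ t * κ) := by
    refine (Finset.sum_le_sum fun c hc => card_fail_le State Fail θ N hθ hdep hzero hstep t m D c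
      (Finset.mem_filter.1 hc).2 hN).trans ?_
    rw [Finset.sum_const, nsmul_eq_mul]
    gcongr
    exact Finset.card_le_univ _
  have h3 := key.trans h2
  refine le_of_mul_le_mul_left (h3.trans (le_of_eq ?_)) hκ0
  ring

end product

open Classical in
-- A product of uniform laws gives every outcome the same mass, so the measure reduces to counting.
lemma choiceMeasure_eq (n k : ℕ) (A : Set (Choices n k)) :
    choiceMeasure n k A = ENNReal.ofReal (pr fun c : Choices n k => c ∈ A) := by
  have hs : ∀ c : Choices n k, choiceMeasure n k {c} = ENNReal.ofReal (1 / Fintype.card (Choices n k)) := by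
    intro c
    unfold choiceMeasure
    rw [← Set.univ_pi_singleton, Measure.pi_pi, Fintype.card_pi]
    simp only [PMF.toMeasure_apply_singleton _ _ (MeasurableSet.singleton _),
      PMF.uniformOfFintype_apply]
    rw [one_div, Nat.cast_prod, ← Finset.prod_inv_distrib, ENNReal.ofReal_prod_of_nonneg
      (fun _ _ => by positivity)]
    refine Finset.prod_congr rfl fun p _ => ?_
    rw [ENNReal.ofReal_inv_of_pos (Nat.cast_pos.2 Fintype.card_pos), ENNReal.ofReal_natCast]
  have hA : A = ((Finset.univ.filter fun c => c ∈ A : Finset (Choices n k)) : Set (Choices n k)) := by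
    ext c; simp
  conv_lhs => rw [hA]
  rw [← MeasureTheory.sum_measure_singleton]
  simp only [hs]
  rw [Finset.sum_const, pr_eq, nsmul_eq_mul, div_eq_mul_one_div (Nat.cast _),
    ENNReal.ofReal_mul (Nat.cast_nonneg _), ENNReal.ofReal_natCast]

end UniformAttachment

namespace UniformAttachment

/-! ### Estimates for the probability that two sets are not joined -/

section missProd

/-- The number of elements of `S` below `j`. -/
def below (S : Finset ℕ) (j : ℕ) : ℕ := (S.filter (· < j)).card

/-- The probability that, in a bipartite attachment graph with one choice per vertex, no edge joins
`S` on the left to `T` on the right. -/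
noncomputable def missProd (S T : Finset ℕ) : ℝ :=
  (∏ j ∈ S, (1 - (below T j : ℝ) / j)) * ∏ j ∈ T, (1 - (below S j : ℝ) / j)

lemma below_le (S : Finset ℕ) (j : ℕ) : below S j ≤ j := by
  have : S.filter (· < j) ⊆ Finset.range j := by
    intro x hx; simp at hx ⊢; exact hx.2
  simpa [below] using Finset.card_le_card this

lemma add_card_le_below {S : Finset ℕ} {n j : ℕ} (hS : S ⊆ Finset.range n) (hj : j ≤ n) :
    j + S.card ≤ below S j + n := by
  have h1 : (Finset.range j ∪ S).card ≤ n := by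
    have : Finset.range j ∪ S ⊆ Finset.range n :=
      Finset.union_subset (by intro x; simp; omega) hS
    simpa using Finset.card_le_card this
  have h2 := Finset.card_union_add_card_inter (Finset.range j) S
  have h3 : Finset.range j ∩ S = S.filter (· < j) := by ext x; simp [and_comm]
  rw [h3, Finset.card_range] at h2
  unfold below
  omega

lemma one_sub_below_div_nonneg (S : Finset ℕ) (j : ℕ) : 0 ≤ 1 - (below S j : ℝ) / j := by
  rw [sub_nonneg]
  apply div_le_one_of_le₀ _ (by positivity)
  exact_mod_cast below_le S j

lemma missProd_nonneg (S T : Finset ℕ) : 0 ≤ missProd S T :=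
  mul_nonneg (Finset.prod_nonneg fun _ _ => one_sub_below_div_nonneg _ _)
    (Finset.prod_nonneg fun _ _ => one_sub_below_div_nonneg _ _)

lemma prod_one_sub_below_le (S T : Finset ℕ) :
    ∏ j ∈ T, (1 - (below S j : ℝ) / j) ≤ Real.exp (-∑ j ∈ T, (below S j : ℝ) / j) := by
  rw [← Finset.sum_neg_distrib, Real.exp_sum]
  refine Finset.prod_le_prod (fun j _ => one_sub_below_div_nonneg S j) fun j _ => ?_
  have := Real.add_one_le_exp (-((below S j : ℝ) / j))
  linarith

lemma sum_below_mul (S T : Finset ℕ) (f : ℕ → ℝ) :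
    ∑ j ∈ T, (below S j : ℝ) * f j = ∑ i ∈ S, ∑ j ∈ T, if i < j then f j else 0 := by
  rw [Finset.sum_comm]
  refine Finset.sum_congr rfl fun j _ => ?_
  rw [← Finset.sum_filter, Finset.sum_const, nsmul_eq_mul]
  rfl

lemma log_div_le_sum_Ico {m n : ℕ} (hm : 0 < m) (hmn : m ≤ n) :
    Real.log (n / m) ≤ ∑ j ∈ Finset.Ico m n, (1 : ℝ) / j := by
  induction n, hmn using Nat.le_induction with
  | base =>
    have : (m : ℝ) ≠ 0 := by exact_mod_cast hm.ne'
    simp [div_self this]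
  | succ n hmn ih =>
    rw [Finset.sum_Ico_succ_top hmn]
    have hn : (0 : ℝ) < n := by exact_mod_cast hm.trans_le hmn
    have hm' : (0 : ℝ) < m := by exact_mod_cast hm
    have h1 : ((n + 1 : ℕ) : ℝ) / m = (n / m) * (1 + 1 / n) := by
      push_cast; field_simp
    rw [h1, Real.log_mul (by positivity) (by positivity)]
    have := Real.log_le_sub_one_of_pos (show (0 : ℝ) < 1 + 1 / n by positivity)
    linarith

/-- As `1/j` decreases, the sum is least when `T` omits the `w` numbers just above `i`; what remains
is compared with a logarithm. -/
lemma log_div_le_sum_inv {T : Finset ℕ} {n w i : ℕ} (hT : T ⊆ Finset.range n)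
    (hw : n ≤ T.card + w) :
    Real.log (n / (i + w + 1 : ℕ)) ≤ ∑ j ∈ T, if i < j then (1 : ℝ) / j else 0 := by
  have hpos : (0 : ℝ) < (i + w + 1 : ℕ) := by positivity
  rcases lt_or_ge n (i + w + 1) with h | h
  · have h0 : 0 ≤ ∑ j ∈ T, if i < j then (1 : ℝ) / j else 0 :=
      Finset.sum_nonneg fun j _ => by split_ifs <;> positivity
    refine le_trans (Real.log_nonpos (by positivity) ?_) h0
    rw [div_le_one hpos]
    exact_mod_cast h.le
  refine (log_div_le_sum_Ico (by omega) h).trans ?_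
  rw [← Finset.sum_filter]
  set A := T.filter (i < ·) with hA
  set B := Finset.Ico (i + w + 1) n with hB
  have hcard : B.card ≤ A.card := by
    have h1 : T ⊆ A ∪ Finset.range (i + 1) := by
      intro x hx
      simp only [hA, Finset.mem_union, Finset.mem_filter, Finset.mem_range]
      by_cases h : i < x
      · exact Or.inl ⟨hx, h⟩
      · right; omega
    have h2 := (Finset.card_le_card h1).trans (Finset.card_union_le _ _)
    rw [Finset.card_range] at h2
    rw [hB, Nat.card_Ico]
    omega
  have hcard' : (B \ A).card ≤ (A \ B).card := by
    have := Finset.card_sdiff_add_card_inter A B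
    have h2 := Finset.card_sdiff_add_card_inter B A
    rw [Finset.inter_comm] at h2
    omega
  rw [← Finset.sum_inter_add_sum_sdiff A B, ← Finset.sum_inter_add_sum_sdiff B A, Finset.inter_comm B A]
  refine add_le_add le_rfl ?_
  calc ∑ j ∈ B \ A, (1 : ℝ) / j ≤ ∑ j ∈ B \ A, (1 : ℝ) / (i + w + 1 : ℕ) := by
        refine Finset.sum_le_sum fun j hj => ?_
        apply one_div_le_one_div_of_le hpos
        have := (Finset.mem_Ico.1 (Finset.mem_sdiff.1 hj).1).1
        exact_mod_cast this
    _ ≤ ∑ j ∈ A \ B, (1 : ℝ) / (i + w + 1 : ℕ) := by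
        rw [Finset.sum_const, Finset.sum_const, nsmul_eq_mul, nsmul_eq_mul]
        gcongr
    _ ≤ ∑ j ∈ A \ B, (1 : ℝ) / j := by
        refine Finset.sum_le_sum fun j hj => ?_
        obtain ⟨h1, h2⟩ := Finset.mem_sdiff.1 hj
        obtain ⟨h3, h4⟩ := Finset.mem_filter.1 h1
        have h5 := Finset.mem_range.1 (hT h3)
        rw [hB, Finset.mem_Ico] at h2
        apply one_div_le_one_div_of_le
        · exact_mod_cast (by omega : 0 < j)
        · exact_mod_cast (by omega : j ≤ i + w + 1)

/-- A bound for small sets `S`. -/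
lemma missProd_le_pow {S T : Finset ℕ} {n w : ℕ} (hS : S ⊆ Finset.range n)
    (hT : T ⊆ Finset.range n) (hw : n ≤ T.card + w) :
    missProd S T ≤ ((2 * w + 1 : ℝ) / n) ^ S.card := by
  rcases Nat.eq_zero_or_pos n with rfl | hn
  · simp at hS hT
    subst hS hT
    simp [missProd]
  have hn' : (0 : ℝ) < n := by exact_mod_cast hn
  -- Exchanging sums, each `i ∈ S` contributes `exp (-∑ 1/j)` over the `j ∈ T` above `i`.
  have h2 : ∏ j ∈ T, (1 - (below S j : ℝ) / j) ≤ ∏ i ∈ S, ((i + w + 1 : ℕ) : ℝ) / n := by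
    refine (prod_one_sub_below_le S T).trans ?_
    have e : ∏ i ∈ S, ((i + w + 1 : ℕ) : ℝ) / n =
        Real.exp (-∑ i ∈ S, Real.log (n / (i + w + 1 : ℕ))) := by
      rw [← Finset.sum_neg_distrib, Real.exp_sum]
      refine Finset.prod_congr rfl fun i _ => ?_
      rw [← Real.log_inv, inv_div, Real.exp_log]
      positivity
    rw [e]
    gcongr
    have := sum_below_mul S T fun j => (1 : ℝ) / j
    simp only [mul_one_div] at this
    rw [this]
    exact Finset.sum_le_sum fun i _ => log_div_le_sum_inv hT hw
  unfold missProd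
  rw [← Finset.prod_const]
  refine (mul_le_mul_of_nonneg_left h2
    (Finset.prod_nonneg fun _ _ => one_sub_below_div_nonneg _ _)).trans ?_
  rw [← Finset.prod_mul_distrib]
  refine Finset.prod_le_prod (fun j _ => mul_nonneg (one_sub_below_div_nonneg _ _) (by positivity))
    fun j hj => ?_
  have hjn := Finset.mem_range.1 (hS hj)
  have hb := add_card_le_below hT hjn.le
  have h1 : 1 - (below T j : ℝ) / j ≤ 1 := by
    have : (0 : ℝ) ≤ (below T j : ℝ) / j := by positivity
    linarith
  -- The factor of `j ∈ S` itself is at most 1, and at most `w / j` when `j > w`. Either bound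
  -- brings `(j + w + 1) / n` down to `(2w + 1) / n`.
  rcases le_or_gt j w with h | h
  · refine (mul_le_of_le_one_left (by positivity) h1).trans ?_
    gcongr
    push_cast
    have : (j : ℝ) ≤ w := by exact_mod_cast h
    linarith
  · have hj0 : (0 : ℝ) < j := by exact_mod_cast (by omega : 0 < j)
    have h3 : 1 - (below T j : ℝ) / j ≤ w / j := by
      rw [sub_le_iff_le_add, ← add_div, le_div_iff₀ hj0, one_mul]
      exact_mod_cast (by omega : j ≤ w + below T j)
    refine (mul_le_mul_of_nonneg_right h3 (by positivity)).trans ?_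
    rw [div_mul_div_comm, div_le_div_iff₀ (by positivity) hn']
    have h4 : (w : ℝ) + 1 ≤ j := by exact_mod_cast h
    have hw0 : (0 : ℝ) ≤ w := by positivity
    push_cast
    have : (w : ℝ) * (j + w + 1) ≤ (2 * w + 1) * j := by nlinarith
    nlinarith

/-- Off the diagonal the right side is `2n - max i j`, and `n - max i j` counts the levels `m ≤ n`
above both `i` and `j`. Summed over pairs this gives products of `below S m` and `below T m`. -/
lemma pair_bound (n i j : ℕ) (hi : i < n) (hj : j < n) :
    (n : ℝ) + (∑ m ∈ Finset.range (n + 1), if i < m ∧ j < m then (1 : ℝ) else 0) -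
      (if i = j then 2 * (n : ℝ) else 0) ≤
    (if i < j then 2 * (n : ℝ) - j else 0) + (if j < i then 2 * (n : ℝ) - i else 0) := by
  have h : (∑ m ∈ Finset.range (n + 1), if i < m ∧ j < m then (1 : ℝ) else 0) =
      n - (max i j : ℕ) := by
    rw [Finset.sum_boole]
    have : (Finset.range (n + 1)).filter (fun m => i < m ∧ j < m) =
        Finset.Ico (max i j + 1) (n + 1) := by
      ext m; simp; omega
    rw [this, Nat.card_Ico, eq_sub_iff_add_eq]
    norm_cast
    have := max_lt hi hj
    omega
  rw [h]
  rcases lt_trichotomy i j with hlt | rfl | hlt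
  · rw [if_neg hlt.ne, if_pos hlt, if_neg hlt.not_gt, max_eq_right hlt.le]; linarith
  · simp
    have : (i : ℝ) ≥ 0 := by positivity
    linarith
  · rw [if_neg hlt.ne', if_pos hlt, if_neg hlt.not_gt, max_eq_left hlt.le]; linarith

/-- By convexity `1/j` lies above its tangent at `j = n`, which is `(2n - j) / n²`. -/
lemma sum_below_div_ge {S T : Finset ℕ} {n : ℕ} (hn : 0 < n) :
    (1 / (n : ℝ) ^ 2) * ∑ i ∈ S, ∑ j ∈ T, (if i < j then 2 * (n : ℝ) - j else 0) ≤
      ∑ j ∈ T, (below S j : ℝ) / j := by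
  rw [← sum_below_mul S T fun j => 2 * (n : ℝ) - j, Finset.mul_sum]
  refine Finset.sum_le_sum fun j _ => ?_
  rcases Nat.eq_zero_or_pos j with rfl | hj
  · have : below S 0 = 0 := Nat.le_zero.1 (below_le S 0)
    simp [this]
  have hj' : (0 : ℝ) < j := by exact_mod_cast hj
  have hn' : (0 : ℝ) < n := by exact_mod_cast hn
  have h : (1 / (n : ℝ) ^ 2) * (2 * n - j) ≤ 1 / j := by
    rw [one_div_mul_eq_div, div_le_div_iff₀ (by positivity) hj']
    nlinarith [sq_nonneg ((n : ℝ) - j)]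
  calc (1 / (n : ℝ) ^ 2) * ((below S j : ℝ) * (2 * n - j)) =
        (below S j : ℝ) * ((1 / (n : ℝ) ^ 2) * (2 * n - j)) := by ring
    _ ≤ (below S j : ℝ) * (1 / j) := by gcongr
    _ = (below S j : ℝ) / j := by ring

lemma sum_range_quadratic (d s : ℕ) :
    (d : ℝ) * s ^ 2 / 2 + (s : ℝ) ^ 3 / 3 ≤ ∑ r ∈ Finset.range (s + 1), (r : ℝ) * (d + r) := by
  have : ∑ r ∈ Finset.range (s + 1), (r : ℝ) * (d + r) =
      d * s * (s + 1) / 2 + s * (s + 1) * (2 * s + 1) / 6 := by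
    induction s with
    | zero => simp
    | succ s ih => rw [Finset.sum_range_succ, ih]; push_cast; ring
  rw [this]
  have h1 : (0 : ℝ) ≤ d * s := by positivity
  have h2 : (0 : ℝ) ≤ s := by positivity
  nlinarith [sq_nonneg (s : ℝ)]

/-- A bound for sets `S` and `T` of linear size. -/
lemma missProd_le_exp {S T : Finset ℕ} {n : ℕ} (hS : S ⊆ Finset.range n)
    (hT : T ⊆ Finset.range n) (hST : S.card + T.card = n) (h2 : 2 * S.card ≤ n) (hn : 0 < n) :
    missProd S T ≤ Real.exp (2 - (S.card - (S.card : ℝ) ^ 2 / (2 * n) -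
      2 * (S.card : ℝ) ^ 3 / (3 * n ^ 2))) := by
  have hn' : (0 : ℝ) < n := by exact_mod_cast hn
  unfold missProd
  refine (mul_le_mul (prod_one_sub_below_le T S) (prod_one_sub_below_le S T)
    (Finset.prod_nonneg fun _ _ => one_sub_below_div_nonneg _ _) (Real.exp_pos _).le).trans ?_
  rw [← Real.exp_add]
  apply Real.exp_le_exp.2
  have hA := sum_below_div_ge (S := S) (T := T) hn
  have hB := sum_below_div_ge (S := T) (T := S) hn
  rw [Finset.sum_comm] at hB
  have hpair : ∑ i ∈ S, ∑ j ∈ T, ((n : ℝ) +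
      (∑ m ∈ Finset.range (n + 1), if i < m ∧ j < m then (1 : ℝ) else 0) -
      (if i = j then 2 * (n : ℝ) else 0)) ≤
      ∑ i ∈ S, ∑ j ∈ T, (if i < j then 2 * (n : ℝ) - j else 0) +
      ∑ i ∈ S, ∑ j ∈ T, (if j < i then 2 * (n : ℝ) - i else 0) := by
    rw [← Finset.sum_add_distrib]
    refine Finset.sum_le_sum fun i hi => ?_
    rw [← Finset.sum_add_distrib]
    exact Finset.sum_le_sum fun j hj => pair_bound n i j (Finset.mem_range.1 (hS hi))
      (Finset.mem_range.1 (hT hj))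
  -- `S` and `T` may overlap, being sets of left and right copies; the diagonal accounts for the 2
  -- in the exponent.
  have hdiag : ∑ i ∈ S, ∑ j ∈ T, (if i = j then 2 * (n : ℝ) else 0) ≤ 2 * n ^ 2 := by
    calc ∑ i ∈ S, ∑ j ∈ T, (if i = j then 2 * (n : ℝ) else 0) ≤ ∑ i ∈ S, 2 * (n : ℝ) := by
          refine Finset.sum_le_sum fun i _ => ?_
          rw [Finset.sum_ite_eq]
          split_ifs <;> linarith
      _ = S.card * (2 * n) := by rw [Finset.sum_const, nsmul_eq_mul]
      _ ≤ n * (2 * n) := by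
          gcongr
          omega
      _ = _ := by ring
  have hlevel : ∑ i ∈ S, ∑ j ∈ T, (∑ m ∈ Finset.range (n + 1), if i < m ∧ j < m then (1 : ℝ) else 0) =
      ∑ m ∈ Finset.range (n + 1), (below S m : ℝ) * below T m := by
    have : ∀ m, (below S m : ℝ) * below T m =
        ∑ i ∈ S, ∑ j ∈ T, if i < m ∧ j < m then (1 : ℝ) else 0 := by
      intro m
      unfold below
      rw [← Finset.sum_boole, ← Finset.sum_boole, Finset.sum_mul_sum]
      refine Finset.sum_congr rfl fun i _ => Finset.sum_congr rfl fun j _ => ?_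
      by_cases h1 : i < m <;> by_cases h2 : j < m <;> simp [h1, h2]
    simp only [this]
    rw [Finset.sum_comm (s := Finset.range (n + 1))]
    refine Finset.sum_congr rfl fun i _ => ?_
    rw [Finset.sum_comm]
  -- Only the levels `m = n - s + r` with `0 ≤ r ≤ s = |S|` are used: there at least `r` elements of
  -- `S` and `n - 2s + r` of `T` lie below `m`.
  have hlow : ((n - 2 * S.card : ℕ) : ℝ) * (S.card : ℝ) ^ 2 / 2 + (S.card : ℝ) ^ 3 / 3 ≤
      ∑ m ∈ Finset.range (n + 1), (below S m : ℝ) * below T m := by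
    refine (sum_range_quadratic _ _).trans ?_
    have e : n + 1 = (n - S.card) + (S.card + 1) := by omega
    rw [e, Finset.sum_range_add _ (n - S.card)]
    have h0 : 0 ≤ ∑ m ∈ Finset.range (n - S.card), (below S m : ℝ) * below T m :=
      Finset.sum_nonneg fun _ _ => by positivity
    refine le_trans ?_ (le_add_of_nonneg_left h0)
    refine Finset.sum_le_sum fun r hr => ?_
    have hr' := Finset.mem_range.1 hr
    have ha := add_card_le_below hS (show n - S.card + r ≤ n by omega)
    have hb := add_card_le_below hT (show n - S.card + r ≤ n by omega)
    gcongr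
    · omega
    · exact_mod_cast (by omega : n - 2 * S.card + r ≤ below T (n - S.card + r))
  simp only [Finset.sum_sub_distrib, Finset.sum_add_distrib, Finset.sum_const, nsmul_eq_mul,
    hlevel] at hpair
  have hT' : (T.card : ℝ) = n - S.card := by
    rw [eq_sub_iff_add_eq, add_comm]; exact_mod_cast hST
  rw [hT'] at hpair
  rw [Nat.cast_sub h2] at hlow
  push_cast at hlow
  set s : ℝ := (S.card : ℝ)
  set X := ∑ i ∈ S, ∑ j ∈ T, (if i < j then 2 * (n : ℝ) - j else 0)
  set Y := ∑ i ∈ S, ∑ j ∈ T, (if j < i then 2 * (n : ℝ) - i else 0)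
  have hXY : s * (n - s) * n + ((n - 2 * s) * s ^ 2 / 2 + s ^ 3 / 3) - 2 * n ^ 2 ≤ X + Y := by
    nlinarith
  have e : s - s ^ 2 / (2 * n) - 2 * s ^ 3 / (3 * n ^ 2) - 2 =
      (1 / (n : ℝ) ^ 2) * (s * (n - s) * n + ((n - 2 * s) * s ^ 2 / 2 + s ^ 3 / 3) - 2 * n ^ 2) := by
    field_simp
    ring
  have hfin := mul_le_mul_of_nonneg_left hXY (show 0 ≤ 1 / (n : ℝ) ^ 2 by positivity)
  rw [← e, mul_add] at hfin
  linarith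

end missProd

end UniformAttachment

namespace UniformAttachment

/-! ### Missing edges between two sets of vertices -/

section noEdge

/-- No choice with index in `Λ₁` goes from `S` to `T`, and none with index in `Λ₂` from `T`
to `S`. -/
def NoEdge {n k : ℕ} (Λ₁ Λ₂ : Finset (Fin k)) (S T : Finset ℕ) (c : Choices n k) : Prop :=
  ∀ p : Fin (n - 1) × Fin k,
    (p.2 ∈ Λ₁ → p.1.val + 1 ∈ S → (c p).val ∉ T) ∧ (p.2 ∈ Λ₂ → p.1.val + 1 ∈ T → (c p).val ∉ S)

lemma card_filter_notMem (T : Finset ℕ) (m : ℕ) :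
    ((Finset.univ.filter fun x : Fin m => x.val ∉ T).card : ℝ) = m - below T m := by
  have h := Finset.card_filter_add_card_filter_not (s := (Finset.univ : Finset (Fin m)))
    (fun x => x.val ∈ T)
  have h2 : (Finset.univ.filter fun x : Fin m => x.val ∈ T).card = below T m := by
    unfold below
    rw [← Finset.card_map Fin.valEmbedding]
    congr 1
    ext x
    simp only [Finset.mem_map, Finset.mem_filter, Finset.mem_univ, true_and, Fin.valEmbedding_apply]
    constructor
    · rintro ⟨y, hy, rfl⟩; exact ⟨hy, y.2⟩
    · rintro ⟨h1, h2⟩; exact ⟨⟨x, h2⟩, h1, rfl⟩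
  rw [h2, Finset.card_univ, Fintype.card_fin] at h
  rw [eq_sub_iff_add_eq, add_comm]
  exact_mod_cast h

/-- Vertex 0 has no slots; `f 0 = 1` lets the product run over all of `S` regardless. -/
lemma prod_slots {n k : ℕ} (Λ : Finset (Fin k)) {S : Finset ℕ} (hS : S ⊆ Finset.range n)
    (f : ℕ → ℝ) (hf : f 0 = 1) :
    ∏ p : Fin (n - 1) × Fin k, (if p.2 ∈ Λ ∧ p.1.val + 1 ∈ S then f (p.1.val + 1) else 1) =
      (∏ j ∈ S, f j) ^ Λ.card := by
  rw [Fintype.prod_prod_type]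
  have h1 : ∀ i : Fin (n - 1), (∏ l : Fin k, if l ∈ Λ ∧ i.val + 1 ∈ S then f (i.val + 1) else 1) =
      (if i.val + 1 ∈ S then f (i.val + 1) else 1) ^ Λ.card := by
    intro i
    by_cases h : i.val + 1 ∈ S
    · simp only [h, and_true, if_true]
      rw [Finset.prod_ite_mem, Finset.univ_inter, Finset.prod_const]
    · simp [h]
  simp only [h1]
  rw [Finset.prod_pow]
  congr 1
  rw [Fin.prod_univ_eq_prod_range (fun i => if i + 1 ∈ S then f (i + 1) else 1)]
  cases n with
  | zero => simp at hS; subst hS; simp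
  | succ n =>
    rw [Nat.add_sub_cancel]
    have := Finset.prod_range_succ' (fun i => if i ∈ S then f i else 1) n
    rw [hf, ite_self, mul_one] at this
    rw [← this, Finset.prod_ite_mem, Finset.inter_eq_right.2 hS]

/-- Either disjointness in `hd` ensures that no slot is subject to both restrictions, so each slot
contributes one factor. -/
lemma pr_noEdge_le {n k K : ℕ} {Λ₁ Λ₂ : Finset (Fin k)} (h₁ : Λ₁.card = K) (h₂ : Λ₂.card = K)
    {S T : Finset ℕ} (hS : S ⊆ Finset.range n) (hT : T ⊆ Finset.range n)
    (hd : Disjoint Λ₁ Λ₂ ∨ Disjoint S T) :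
    pr (fun c : Choices n k => NoEdge Λ₁ Λ₂ S T c) ≤ missProd S T ^ K := by
  classical
  let A : ∀ p : Fin (n - 1) × Fin k, Finset (Fin (p.1.val + 1)) := fun p =>
    Finset.univ.filter fun x => (p.2 ∈ Λ₁ → p.1.val + 1 ∈ S → x.val ∉ T) ∧
      (p.2 ∈ Λ₂ → p.1.val + 1 ∈ T → x.val ∉ S)
  have hA : (fun c : Choices n k => NoEdge Λ₁ Λ₂ S T c) = fun c => ∀ p, c p ∈ A p := by
    funext c
    simp [A, NoEdge]
  rw [hA, pr_pi]
  have hfac : ∀ p : Fin (n - 1) × Fin k, ((A p).card : ℝ) / Fintype.card (Fin (p.1.val + 1)) ≤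
      (if p.2 ∈ Λ₁ ∧ p.1.val + 1 ∈ S then 1 - (below T (p.1.val + 1) : ℝ) / (p.1.val + 1 : ℕ) else 1) *
      (if p.2 ∈ Λ₂ ∧ p.1.val + 1 ∈ T then 1 - (below S (p.1.val + 1) : ℝ) / (p.1.val + 1 : ℕ) else 1) := by
    intro p
    rw [Fintype.card_fin]
    have hpos : (0 : ℝ) < (p.1.val + 1 : ℕ) := by positivity
    have hnot : ∀ U : Finset ℕ, (∀ x ∈ A p, x.val ∉ U) →
        ((A p).card : ℝ) / (p.1.val + 1 : ℕ) ≤ 1 - (below U (p.1.val + 1) : ℝ) / (p.1.val + 1 : ℕ) := by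
      intro U hU
      rw [div_le_iff₀ hpos, sub_mul, one_mul, div_mul_cancel₀ _ hpos.ne', ← card_filter_notMem]
      exact_mod_cast Finset.card_le_card fun x hx =>
        Finset.mem_filter.2 ⟨Finset.mem_univ _, hU x hx⟩
    split_ifs with c1 c2 c2
    · exfalso
      rcases hd with hd | hd
      · exact Finset.disjoint_left.1 hd c1.1 c2.1
      · exact Finset.disjoint_left.1 hd c1.2 c2.2
    · rw [mul_one]
      exact hnot T fun x hx => (Finset.mem_filter.1 hx).2.1 c1.1 c1.2
    · rw [one_mul]
      exact hnot S fun x hx => (Finset.mem_filter.1 hx).2.2 c2.1 c2.2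
    · rw [one_mul, div_le_iff₀ hpos, one_mul]
      have := Finset.card_le_univ (A p)
      rw [Fintype.card_fin] at this
      exact_mod_cast this
  refine (Finset.prod_le_prod (fun p _ => by positivity) fun p _ => hfac p).trans ?_
  rw [Finset.prod_mul_distrib,
    prod_slots Λ₁ hS (fun j => 1 - (below T j : ℝ) / j) (by simp),
    prod_slots Λ₂ hT (fun j => 1 - (below S j : ℝ) / j) (by simp), h₁, h₂, ← mul_pow]
  rfl

end noEdge

/-! ### Expansion from the first twelve choices -/

section expansion

lemma choose_le_pow (n s : ℕ) (hs : 0 < s) : (n.choose s : ℝ) ≤ (Real.exp 1 * n / s) ^ s := by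
  have hs' : (0 : ℝ) < s := by exact_mod_cast hs
  refine (Nat.choose_le_pow_div s n).trans ?_
  have h := Real.pow_div_factorial_le_exp (s : ℝ) hs'.le s
  have hf : (0 : ℝ) < s.factorial := by exact_mod_cast s.factorial_pos
  rw [div_le_iff₀ hf] at h
  rw [div_le_iff₀ hf, div_pow, mul_pow, ← Real.exp_nat_mul, mul_one, div_mul_eq_mul_div,
    le_div_iff₀ (by positivity)]
  nlinarith [pow_nonneg (Nat.cast_nonneg (α := ℝ) n) s]

/-- The slots with the first twelve choices of every vertex. -/
def baseIdx : Finset (Fin 13) := Finset.univ.filter fun l => l.val < 12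

/-- There are a small set `S` and a set `T` missing at most `3|S|` vertices without an edge between
them. -/
def ExpansionFails (n : ℕ) (c : Choices n 13) : Prop :=
  ∃ S T : Finset ℕ, S ⊆ Finset.range n ∧ T ⊆ Finset.range n ∧ Disjoint S T ∧ 0 < S.card ∧
    50 * S.card ≤ n ∧ T.card + 3 * S.card = n ∧ NoEdge baseIdx baseIdx S T c

/-- This is the union bound over `S` and the 3s vertices outside `T`. With `x = s/n` its base is at
most `e⁴ (7¹²/27) x⁸ ≤ x` for `x ≤ 1/50`. One factor `s/n` is kept so that the sum over `s` is
O(1/n). -/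
lemma expansion_term_le {n s : ℕ} (hs : 0 < s) (hn : 50 * s ≤ n) :
    (n.choose s : ℝ) * (n.choose (3 * s)) * (((2 * (3 * s : ℕ) + 1 : ℝ) / n) ^ s) ^ 12 ≤
      (s / n : ℝ) * (1 / 50) ^ (s - 1) := by
  have hs' : (1 : ℝ) ≤ s := by exact_mod_cast hs
  have hn' : (50 : ℝ) * s ≤ n := by exact_mod_cast hn
  have hn0 : (0 : ℝ) < n := by linarith
  have h1 := choose_le_pow n s hs
  have h2 := choose_le_pow n (3 * s) (by omega)
  have h3 : (((2 * (3 * s : ℕ) + 1 : ℝ) / n) ^ s) ^ 12 ≤ ((7 * s / n : ℝ) ^ 12) ^ s := by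
    rw [← pow_mul, ← pow_mul, mul_comm s 12]
    gcongr
    push_cast
    linarith
  have he : Real.exp 1 < 3 := by have := Real.exp_one_lt_d9; linarith
  calc _ ≤ (Real.exp 1 * n / s) ^ s * (Real.exp 1 * n / (3 * s : ℕ)) ^ (3 * s) *
        ((7 * s / n : ℝ) ^ 12) ^ s := by gcongr
    _ = (Real.exp 1 ^ 4 * (7 ^ 12 / 27) * (s / n : ℝ) ^ 8) ^ s := by
        rw [pow_mul, ← mul_pow, ← mul_pow]
        congr 1
        push_cast
        field_simp
        norm_num
    _ ≤ (s / n : ℝ) ^ s := by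
        gcongr
        set x : ℝ := s / n with hx
        have hx0 : 0 ≤ x := by positivity
        have hx1 : x ≤ 1 / 50 := by rw [hx, div_le_div_iff₀ hn0 (by norm_num)]; linarith
        calc Real.exp 1 ^ 4 * (7 ^ 12 / 27) * x ^ 8 ≤ 3 ^ 4 * (7 ^ 12 / 27) * ((1 / 50) ^ 7 * x) := by
              rw [pow_succ x 7]
              gcongr
          _ ≤ x := by
              have : (3 : ℝ) ^ 4 * (7 ^ 12 / 27) * (1 / 50) ^ 7 ≤ 1 := by norm_num
              nlinarith
    _ = (s / n : ℝ) * (s / n) ^ (s - 1) := by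
        rw [← pow_succ', Nat.sub_add_cancel hs]
    _ ≤ _ := by
        refine mul_le_mul_of_nonneg_left (pow_le_pow_left₀ (by positivity) ?_ _) (by positivity)
        rw [div_le_div_iff₀ hn0 (by norm_num)]; linarith

lemma sum_nat_mul_pow_le (N : ℕ) : ∑ s ∈ Finset.Icc 1 N, (s : ℝ) * (1 / 50) ^ (s - 1) ≤ 3 := by
  have h : ∑ s ∈ Finset.Icc 1 N, (s : ℝ) * (1 / 50) ^ (s - 1) ≤ 3 - 2 * (1 / 2) ^ N := by
    induction N with
    | zero => simp; norm_num
    | succ N ih =>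
      rw [Finset.sum_Icc_succ_top (by omega), Nat.add_sub_cancel]
      have : ((N + 1 : ℕ) : ℝ) * (1 / 50) ^ N ≤ (1 / 2) ^ N := by
        have h1 : (N + 1 : ℕ) ≤ 2 ^ N := Nat.lt_two_pow_self
        have h2 : ((N + 1 : ℕ) : ℝ) ≤ 2 ^ N := by exact_mod_cast h1
        calc ((N + 1 : ℕ) : ℝ) * (1 / 50) ^ N ≤ 2 ^ N * (1 / 50) ^ N := by gcongr
          _ = (1 / 25) ^ N := by rw [← mul_pow]; norm_num
          _ ≤ _ := pow_le_pow_left₀ (by norm_num) (by norm_num) _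
      have h3 : ((1 : ℝ) / 2) ^ (N + 1) = (1 / 2) ^ N * (1 / 2) := pow_succ _ _
      linarith
  have : (0 : ℝ) ≤ (1 / 2) ^ N := by positivity
  linarith

lemma pr_expansionFails_le {n : ℕ} (hn : 0 < n) : pr (ExpansionFails n) ≤ 3 / n := by
  have hn0 : (0 : ℝ) < n := by exact_mod_cast hn
  have hcard : baseIdx.card = 12 := by decide
  have hmono : pr (ExpansionFails n) ≤ pr (fun c : Choices n 13 => ∃ s ∈ Finset.Icc 1 (n / 50),
      ∃ S ∈ (Finset.range n).powersetCard s, ∃ T ∈ ((Finset.range n).powersetCard (n - 3 * s)),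
        Disjoint S T ∧ NoEdge baseIdx baseIdx S T c) := by
    refine pr_mono ?_
    rintro c ⟨S, T, hS, hT, hd, h0, h50, hc, hne⟩
    refine ⟨S.card, Finset.mem_Icc.2 ⟨h0, by omega⟩, S, Finset.mem_powersetCard.2 ⟨hS, rfl⟩,
      T, Finset.mem_powersetCard.2 ⟨hT, by omega⟩, hd, hne⟩
  refine hmono.trans ((pr_exists_le _ _).trans ?_)
  have hterm : ∀ s ∈ Finset.Icc 1 (n / 50), pr (fun c : Choices n 13 =>
      ∃ S ∈ (Finset.range n).powersetCard s, ∃ T ∈ ((Finset.range n).powersetCard (n - 3 * s)),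
        Disjoint S T ∧ NoEdge baseIdx baseIdx S T c) ≤ (s / n : ℝ) * (1 / 50) ^ (s - 1) := by
    intro s hs
    obtain ⟨hs1, hs2⟩ := Finset.mem_Icc.1 hs
    have hsn : 50 * s ≤ n := by omega
    refine (pr_exists_le _ _).trans ?_
    refine (Finset.sum_le_sum fun S _ => pr_exists_le _ _).trans ?_
    refine (Finset.sum_le_sum (g := fun S => ∑ T ∈ (Finset.range n).powersetCard (n - 3 * s),
      (((2 * (3 * s : ℕ) + 1 : ℝ) / n) ^ s) ^ 12) fun S hS => Finset.sum_le_sum fun T hT => ?_).trans ?_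
    · obtain ⟨hS1, hS2⟩ := Finset.mem_powersetCard.1 hS
      obtain ⟨hT1, hT2⟩ := Finset.mem_powersetCard.1 hT
      by_cases hd : Disjoint S T
      · refine (pr_mono fun c h => h.2).trans ((pr_noEdge_le hcard hcard hS1 hT1 (Or.inr hd)).trans ?_)
        have := missProd_le_pow (w := 3 * s) hS1 hT1 (by omega)
        rw [hS2] at this
        exact pow_le_pow_left₀ (missProd_nonneg _ _) this _
      · simp only [hd, false_and, pr_eq, Finset.filter_false]
        simp
        positivity
    · rw [Finset.sum_const, Finset.sum_const, Finset.card_powersetCard, Finset.card_powersetCard,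
        Finset.card_range, nsmul_eq_mul, nsmul_eq_mul, Nat.choose_symm (by omega), ← mul_assoc]
      exact expansion_term_le hs1 hsn
  refine (Finset.sum_le_sum hterm).trans ?_
  have : ∀ s ∈ Finset.Icc 1 (n / 50), (s / n : ℝ) * (1 / 50) ^ (s - 1) =
      ((s : ℝ) * (1 / 50) ^ (s - 1)) * (1 / n) := fun s _ => by ring
  rw [Finset.sum_congr rfl this, ← Finset.sum_mul, div_eq_mul_one_div (3 : ℝ)]
  gcongr
  exact sum_nat_mul_pow_le _

end expansion

end UniformAttachment

namespace UniformAttachment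

/-! ### First-moment bound for the bipartite matching -/

section matching

lemma choose_mul_pow_le (n s : ℕ) (hs : s ≤ n) (q : ℝ) (h0 : 0 ≤ q) (h1 : q ≤ 1) :
    (n.choose s : ℝ) * (q ^ s * (1 - q) ^ (n - s)) ≤ 1 := by
  have h := add_pow q (1 - q) n
  rw [add_sub_cancel, one_pow] at h
  have := Finset.single_le_sum (f := fun m => q ^ m * (1 - q) ^ (n - m) * (n.choose m : ℝ))
    (s := Finset.range (n + 1)) (fun m _ => by
      have : 0 ≤ 1 - q := by linarith
      positivity) (Finset.mem_range.2 (Nat.lt_succ_of_le hs))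
  rw [← h] at this
  refine le_trans (le_of_eq ?_) this
  ring

/-- The entropy bound by its tangent at `1/4`: the constants slightly exceed `log 4` and `log
(4/3)`. -/
lemma choose_le_exp (n s : ℕ) (hs : s ≤ n) :
    (n.choose s : ℝ) ≤ Real.exp (1.3864 * s + 0.2915 * (n - s)) := by
  have h := choose_mul_pow_le n s hs (1 / 4) (by norm_num) (by norm_num)
  have h4 : Real.exp (-1.3864) ≤ 1 / 4 := by
    rw [← Real.le_log_iff_exp_le (by norm_num)]
    have : Real.log (1 / 4) = -(2 * Real.log 2) := by
      rw [one_div, Real.log_inv, show (4 : ℝ) = 2 ^ 2 by norm_num, Real.log_pow]; push_cast; ring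
    rw [this]
    have := Real.log_two_lt_d9
    linarith
  have h43 : Real.exp (-0.2915) ≤ 1 - 1 / 4 := by
    rw [Real.exp_neg, inv_le_comm₀ (Real.exp_pos _) (by norm_num)]
    have := Real.quadratic_le_exp_of_nonneg (show (0 : ℝ) ≤ 0.2915 by norm_num)
    norm_num at this ⊢
    linarith
  have key : Real.exp (-(1.3864 * s + 0.2915 * (n - s))) ≤ (1 / 4) ^ s * (1 - 1 / 4) ^ (n - s) := by
    have e : -(1.3864 * (s : ℝ) + 0.2915 * (n - s)) = s * (-1.3864) + (n - s : ℕ) * (-0.2915) := by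
      rw [Nat.cast_sub hs]; ring
    rw [e, Real.exp_add, Real.exp_nat_mul, Real.exp_nat_mul]
    gcongr
  have h5 : (n.choose s : ℝ) * Real.exp (-(1.3864 * s + 0.2915 * (n - s))) ≤ 1 :=
    (mul_le_mul_of_nonneg_left key (by positivity)).trans h
  rw [Real.exp_neg, ← div_eq_mul_inv, div_le_one (Real.exp_pos _)] at h5
  exact h5

/-- The base is `64 e² (s/n)⁴`, below 0.77 when `s/n ≤ 1/5`. The `+ 1` in `2s + 1` costs `exp (1/2)`
per choice, hence `exp 3` for six. -/
lemma pair_term_le_of_small {S T : Finset ℕ} {n : ℕ} (hS : S ⊆ Finset.range n)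
    (hT : T ⊆ Finset.range n) (hST : S.card + T.card = n) (h0 : 0 < S.card) (h5 : 5 * S.card ≤ n) :
    (n.choose S.card : ℝ) ^ 2 * missProd S T ^ 6 ≤ Real.exp 3 * 0.77 ^ S.card := by
  have h1 := missProd_le_pow (w := S.card) hS hT (by omega)
  have hm := missProd_nonneg S T
  set s := S.card with hs
  have hs0 : (0 : ℝ) < s := by exact_mod_cast h0
  have hn5 : (5 : ℝ) * s ≤ n := by exact_mod_cast h5
  have hn0 : (0 : ℝ) < n := by linarith
  have h2 := choose_le_pow n s h0
  have h3 : ((2 * s + 1 : ℝ) / n) ^ s ≤ Real.exp (1 / 2) * (2 * s / n) ^ s := by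
    have : (2 * s + 1 : ℝ) / n ≤ Real.exp (1 / (2 * s)) * (2 * s / n) := by
      have h := Real.add_one_le_exp (1 / (2 * s) : ℝ)
      calc (2 * s + 1 : ℝ) / n = (1 / (2 * s) + 1) * (2 * s / n) := by field_simp; ring
        _ ≤ _ := by gcongr
    calc ((2 * s + 1 : ℝ) / n) ^ s ≤ (Real.exp (1 / (2 * s)) * (2 * s / n)) ^ s := by gcongr
      _ = _ := by
        rw [mul_pow, ← Real.exp_nat_mul]
        congr 2
        field_simp
  calc (n.choose s : ℝ) ^ 2 * missProd S T ^ 6 ≤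
        ((Real.exp 1 * n / s) ^ s) ^ 2 * (Real.exp (1 / 2) * (2 * s / n) ^ s) ^ 6 := by
        gcongr
        exact h1.trans h3
    _ = Real.exp (1 / 2) ^ 6 * (64 * Real.exp 1 ^ 2 * (s / n : ℝ) ^ 4) ^ s := by
        rw [mul_pow, ← pow_mul, ← pow_mul, mul_comm s 2, mul_comm s 6, pow_mul, pow_mul _ 6 s,
          mul_left_comm, ← mul_pow]
        congr 2
        field_simp
        norm_num
    _ ≤ _ := by
        rw [← Real.exp_nat_mul]
        have hx : (s / n : ℝ) ≤ 1 / 5 := by rw [div_le_div_iff₀ hn0 (by norm_num)]; linarith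
        have he := Real.exp_one_lt_d9
        gcongr
        · norm_num
        · calc 64 * Real.exp 1 ^ 2 * (s / n : ℝ) ^ 4 ≤ 64 * 2.7182818286 ^ 2 * (1 / 5) ^ 4 := by gcongr
            _ ≤ _ := by norm_num

/-- Twice the entropy of `x = s/n` must stay below `6 (x - x²/2 - 2x³/3)` on `[1/5, 1/2]`. The
tangent bound serves up to `3/10` and `2 ^ n` beyond, with margin 0.02. -/
lemma pair_term_le_of_large {S T : Finset ℕ} {n : ℕ} (hS : S ⊆ Finset.range n)
    (hT : T ⊆ Finset.range n) (hST : S.card + T.card = n) (hn : 0 < n) (h5 : n ≤ 5 * S.card)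
    (h2 : 2 * S.card ≤ n) :
    (n.choose S.card : ℝ) ^ 2 * missProd S T ^ 6 ≤ Real.exp 12 * Real.exp (-0.02) ^ n := by
  have h1 := missProd_le_exp hS hT hST h2 hn
  have hm := missProd_nonneg S T
  set s := S.card with hs
  have hn0 : (0 : ℝ) < n := by exact_mod_cast hn
  obtain ⟨x, hx⟩ : ∃ x : ℝ, (s : ℝ) = x * n := ⟨s / n, by field_simp⟩
  have hx5 : 1 / 5 ≤ x := by
    have : (n : ℝ) ≤ 5 * s := by exact_mod_cast h5
    rw [hx] at this
    nlinarith
  have hx2 : x ≤ 1 / 2 := by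
    have : (2 : ℝ) * s ≤ n := by exact_mod_cast h2
    rw [hx] at this
    nlinarith
  have e : 2 - ((s : ℝ) - (s : ℝ) ^ 2 / (2 * n) - 2 * (s : ℝ) ^ 3 / (3 * n ^ 2)) =
      2 - n * (x - x ^ 2 / 2 - 2 * x ^ 3 / 3) := by
    rw [hx]; field_simp
  rw [e] at h1
  obtain ⟨y, hy, hyx⟩ : ∃ y : ℝ, (n.choose s : ℝ) ≤ Real.exp (n * y) ∧
      2 * y + 0.02 ≤ 6 * (x - x ^ 2 / 2 - 2 * x ^ 3 / 3) := by
    rcases le_or_gt x (3 / 10) with h | h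
    · refine ⟨1.3864 * x + 0.2915 * (1 - x), ?_, ?_⟩
      · refine (choose_le_exp n s (by omega)).trans (le_of_eq ?_)
        rw [hx]; ring_nf
      · nlinarith [mul_nonneg (sub_nonneg.2 hx5) (sub_nonneg.2 h),
          mul_nonneg (mul_nonneg (sub_nonneg.2 hx5) (sub_nonneg.2 h)) (show 0 ≤ x by linarith)]
    · refine ⟨0.6932, ?_, ?_⟩
      · have h3 : (n.choose s : ℝ) ≤ 2 ^ n := by exact_mod_cast Nat.choose_le_two_pow n s
        refine h3.trans ?_
        rw [Real.exp_nat_mul]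
        gcongr
        rw [← Real.log_le_iff_le_exp (by norm_num)]
        have := Real.log_two_lt_d9
        linarith
      · nlinarith [mul_nonneg (sub_nonneg.2 h.le) (sub_nonneg.2 hx2),
          mul_nonneg (mul_nonneg (sub_nonneg.2 h.le) (sub_nonneg.2 hx2)) (show 0 ≤ x by linarith)]
  calc (n.choose s : ℝ) ^ 2 * missProd S T ^ 6 ≤
        Real.exp (n * y) ^ 2 * Real.exp (2 - n * (x - x ^ 2 / 2 - 2 * x ^ 3 / 3)) ^ 6 := by gcongr
    _ = Real.exp (12 + n * (2 * y - 6 * (x - x ^ 2 / 2 - 2 * x ^ 3 / 3))) := by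
        rw [← Real.exp_nat_mul, ← Real.exp_nat_mul, ← Real.exp_add]
        congr 1
        push_cast
        ring
    _ ≤ Real.exp (12 + n * (-0.02)) := by
        gcongr
        linarith
    _ = _ := by rw [Real.exp_add, ← Real.exp_nat_mul]

lemma exists_pair_term_le {ε : ℝ} (hε : 0 < ε) : ∃ θ : ℝ, 0 < θ ∧ θ < 1 ∧
    ∀ (n : ℕ) (S T : Finset ℕ), 0 < n → S ⊆ Finset.range n → T ⊆ Finset.range n →
      S.card + T.card = n → ε * n ≤ S.card → 2 * S.card ≤ n →
      (n.choose S.card : ℝ) ^ 2 * missProd S T ^ 6 ≤ Real.exp 12 * θ ^ n := by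
  refine ⟨max (0.77 ^ ε) (Real.exp (-0.02)), lt_max_of_lt_right (Real.exp_pos _),
    max_lt (Real.rpow_lt_one (by norm_num) (by norm_num) hε) (by rw [Real.exp_lt_one_iff]; norm_num), ?_⟩
  intro n S T hn hS hT hST hs h2
  have hn0 : (0 : ℝ) < n := by exact_mod_cast hn
  rcases le_or_gt (5 * S.card) n with h5 | h5
  · have hs0 : (0 : ℝ) < S.card := lt_of_lt_of_le (by positivity) hs
    refine (pair_term_le_of_small hS hT hST (by exact_mod_cast hs0) h5).trans ?_
    gcongr
    · norm_num
    · calc (0.77 : ℝ) ^ S.card = 0.77 ^ (S.card : ℝ) := (Real.rpow_natCast _ _).symm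
        _ ≤ 0.77 ^ (ε * n) := Real.rpow_le_rpow_of_exponent_ge (by norm_num) (by norm_num) hs
        _ = (0.77 ^ ε) ^ n := by rw [Real.rpow_mul (by norm_num), Real.rpow_natCast]
        _ ≤ _ := by
          gcongr
          exact le_max_left _ _
  · refine (pair_term_le_of_large hS hT hST hn h5.le h2).trans ?_
    gcongr
    exact le_max_right _ _

/-- The indices of the choices made by the left copies of the vertices. -/
def leftIdx : Finset (Fin 13) := Finset.univ.filter fun l => l.val < 6

/-- The indices of the choices made by the right copies of the vertices. -/
def rightIdx : Finset (Fin 13) := Finset.univ.filter fun l => 6 ≤ l.val ∧ l.val < 12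

/-- There are a set of left vertices and a set of right vertices, of total size `n` and neither
small, without an edge between them. -/
def MatchingFails (n : ℕ) (ε : ℝ) (c : Choices n 13) : Prop :=
  ∃ S T : Finset ℕ, S ⊆ Finset.range n ∧ T ⊆ Finset.range n ∧ S.card + T.card = n ∧
    ε * n ≤ S.card ∧ ε * n ≤ T.card ∧ NoEdge leftIdx rightIdx S T c

/-- By symmetry the smaller of the two sets is called `S`; this allows both assignments of the index
sets, whence the factor 2. -/
lemma exists_pr_matchingFails_le {ε : ℝ} (hε : 0 < ε) : ∃ θ : ℝ, 0 < θ ∧ θ < 1 ∧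
    ∀ n : ℕ, 0 < n → pr (MatchingFails n ε) ≤ (n + 1) * (2 * Real.exp 12 * θ ^ n) := by
  obtain ⟨θ, h0, h1, hθ⟩ := exists_pair_term_le hε
  refine ⟨θ, h0, h1, fun n hn => ?_⟩
  have hl : leftIdx.card = 6 := by decide
  have hr : rightIdx.card = 6 := by decide
  have hd : Disjoint leftIdx rightIdx := by decide
  have hmono : pr (MatchingFails n ε) ≤ pr (fun c : Choices n 13 => ∃ s ∈ Finset.range (n + 1),
      ∃ S ∈ (Finset.range n).powersetCard s, ∃ T ∈ ((Finset.range n).powersetCard (n - s)),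
        (ε * n ≤ s ∧ 2 * s ≤ n) ∧ (NoEdge leftIdx rightIdx S T c ∨ NoEdge rightIdx leftIdx S T c)) := by
    refine pr_mono ?_
    rintro c ⟨S, T, hS, hT, hST, hs, ht, hne⟩
    rcases le_or_gt (2 * S.card) n with h | h
    · exact ⟨S.card, Finset.mem_range.2 (by omega), S, Finset.mem_powersetCard.2 ⟨hS, rfl⟩, T,
        Finset.mem_powersetCard.2 ⟨hT, by omega⟩, ⟨hs, h⟩, Or.inl hne⟩
    · exact ⟨T.card, Finset.mem_range.2 (by omega), T, Finset.mem_powersetCard.2 ⟨hT, rfl⟩, S,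
        Finset.mem_powersetCard.2 ⟨hS, by omega⟩, ⟨ht, by omega⟩,
        Or.inr fun p => ⟨(hne p).2, (hne p).1⟩⟩
  refine hmono.trans ((pr_exists_le _ _).trans ?_)
  rw [show ((n : ℝ) + 1) * (2 * Real.exp 12 * θ ^ n) =
    ∑ s ∈ Finset.range (n + 1), (2 * Real.exp 12 * θ ^ n) by
      rw [Finset.sum_const, Finset.card_range, nsmul_eq_mul]; push_cast; ring]
  refine Finset.sum_le_sum fun s hs => ?_
  have hsn : s ≤ n := Nat.lt_succ_iff.1 (Finset.mem_range.1 hs)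
  by_cases hcond : ε * n ≤ s ∧ 2 * s ≤ n
  swap
  · simp only [hcond, false_and, and_false, exists_false, pr_eq, Finset.filter_false]
    simp
    positivity
  have hC : (0 : ℝ) < n.choose s := by exact_mod_cast Nat.choose_pos hsn
  refine (pr_exists_le _ _).trans ?_
  refine (Finset.sum_le_sum fun S _ => pr_exists_le _ _).trans ?_
  refine (Finset.sum_le_sum (g := fun S => ∑ T ∈ (Finset.range n).powersetCard (n - s),
    2 * (Real.exp 12 * θ ^ n / (n.choose s : ℝ) ^ 2)) fun S hS =>
      Finset.sum_le_sum fun T hT => ?_).trans ?_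
  · obtain ⟨hS1, hS2⟩ := Finset.mem_powersetCard.1 hS
    obtain ⟨hT1, hT2⟩ := Finset.mem_powersetCard.1 hT
    have hmain := hθ n S T hn hS1 hT1 (by omega) (by rw [hS2]; exact hcond.1) (by omega)
    rw [hS2] at hmain
    have hm : missProd S T ^ 6 ≤ Real.exp 12 * θ ^ n / (n.choose s : ℝ) ^ 2 := by
      rw [le_div_iff₀ (by positivity), mul_comm]; exact hmain
    refine (pr_mono fun c h => h.2).trans ((pr_or_le _ _).trans ?_)
    have h1 := pr_noEdge_le (n := n) hl hr hS1 hT1 (Or.inl hd)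
    have h2 := pr_noEdge_le (n := n) hr hl hS1 hT1 (Or.inl hd.symm)
    linarith
  · rw [Finset.sum_const, Finset.sum_const, Finset.card_powersetCard, Finset.card_powersetCard,
      Finset.card_range, nsmul_eq_mul, nsmul_eq_mul, Nat.choose_symm hsn]
    apply le_of_eq
    field_simp

end matching

/-! ### The expected number of short arc cycles -/

section shortCycles

/-- An edge of the bipartite graph between the left copy of `v` and the right copy of `u`. -/
def Arc {n : ℕ} (c : Choices n 13) (v u : ℕ) : Prop :=
  (∃ p : Fin (n - 1) × Fin 13, p.2 ∈ leftIdx ∧ p.1.val + 1 = v ∧ (c p).val = u) ∨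
    ∃ p : Fin (n - 1) × Fin 13, p.2 ∈ rightIdx ∧ p.1.val + 1 = u ∧ (c p).val = v

/-- Prescribing the values of distinct choices. -/
lemma pr_values_le {n k : ℕ} {I : Type*} [Fintype I] (q : I → Fin (n - 1) × Fin k)
    (hq : Function.Injective q) (y : I → ℕ) :
    pr (fun c : Choices n k => ∀ i, (c (q i)).val = y i) ≤ ∏ i, (1 : ℝ) / ((q i).1.val + 1) := by
  classical
  let A : ∀ p : Fin (n - 1) × Fin k, Finset (Fin (p.1.val + 1)) := fun p =>
    Finset.univ.filter fun x => ∀ i, q i = p → x.val = y i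
  have hA : ∀ c : Choices n k, (∀ i, (c (q i)).val = y i) → ∀ p, c p ∈ A p := by
    intro c hc p
    simp only [A, Finset.mem_filter, Finset.mem_univ, true_and]
    rintro i rfl
    exact hc i
  refine (pr_mono hA).trans ?_
  rw [pr_pi]
  calc ∏ p, ((A p).card : ℝ) / Fintype.card (Fin (p.1.val + 1)) ≤
      ∏ p, if p ∈ Finset.univ.image q then (1 : ℝ) / (p.1.val + 1) else 1 := by
        refine Finset.prod_le_prod (fun p _ => by positivity) fun p _ => ?_
        rw [Fintype.card_fin]
        have hpos : (0 : ℝ) < (p.1.val + 1 : ℕ) := by positivity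
        split_ifs with h
        · obtain ⟨i, -, rfl⟩ := Finset.mem_image.1 h
          push_cast
          gcongr
          have : (A (q i)).card ≤ 1 := by
            rw [Finset.card_le_one]
            intro a ha b hb
            have h1 := (Finset.mem_filter.1 ha).2 i rfl
            have h2 := (Finset.mem_filter.1 hb).2 i rfl
            exact Fin.ext (h1.trans h2.symm)
          exact_mod_cast this
        · rw [div_le_one hpos]
          have := Finset.card_le_univ (A p)
          rw [Fintype.card_fin] at this
          exact_mod_cast this
    _ = ∏ i, (1 : ℝ) / ((q i).1.val + 1) := by
        rw [Finset.prod_ite_mem, Finset.univ_inter, Finset.prod_image fun a _ b _ h => hq h]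

lemma one_div_max_le {a b m : ℝ} (ha : 0 < a) (hb : 0 < b) (h1 : a ≤ 2 * m) (h2 : b ≤ 2 * m) :
    1 / m ≤ 2 * (1 / √a * (1 / √b)) := by
  have hm : 0 < m := by linarith
  have h : √a * √b ≤ 2 * m := by
    rw [← Real.sqrt_mul ha.le]
    apply Real.sqrt_le_iff.2 ⟨by linarith, by nlinarith⟩
  have h3 : 0 < √a * √b := mul_pos (Real.sqrt_pos.2 ha) (Real.sqrt_pos.2 hb)
  rw [one_div_mul_one_div, mul_one_div, div_le_div_iff₀ hm h3]
  linarith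

open Classical in
-- An arc comes from one of at most twelve slots, all owned by its later end, and `1 / max` is at
-- most twice the product of inverse square roots over both ends. Each vertex is the tail of one arc
-- and the head of one, so the square roots combine to `1 / (v + 1)`.
lemma pr_arcs_le {n : ℕ} {I : Type*} [Fintype I] [DecidableEq I] (τ : Equiv.Perm I) (x : I → Fin n)
    (hx : Function.Injective x) :
    pr (fun c : Choices n 13 => ∀ i, Arc c (x i) (x (τ i))) ≤
      ∏ i, (24 : ℝ) * (1 / ((x i).val + 1)) := by
  let Q : I → Finset (Fin (n - 1) × Fin 13) := fun i => Finset.univ.filter fun p =>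
    (p.2 ∈ leftIdx ∧ p.1.val + 1 = (x i).val ∧ (x (τ i)).val ≤ p.1.val) ∨
    (p.2 ∈ rightIdx ∧ p.1.val + 1 = (x (τ i)).val ∧ (x i).val ≤ p.1.val)
  let y : I → Fin (n - 1) × Fin 13 → ℕ := fun i p => if p.2 ∈ leftIdx then x (τ i) else x i
  have hdisj : ∀ l, l ∈ rightIdx → l ∉ leftIdx := by decide
  have hmono : pr (fun c : Choices n 13 => ∀ i, Arc c (x i) (x (τ i))) ≤
      pr (fun c : Choices n 13 => ∃ q ∈ Fintype.piFinset Q, ∀ i, (c (q i)).val = y i (q i)) := by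
    refine pr_mono fun c hc => ?_
    have : ∀ i, ∃ p ∈ Q i, (c p).val = y i p := by
      intro i
      rcases hc i with ⟨p, h1, h2, h3⟩ | ⟨p, h1, h2, h3⟩
      · refine ⟨p, Finset.mem_filter.2 ⟨Finset.mem_univ _, Or.inl ⟨h1, h2, ?_⟩⟩, ?_⟩
        · have := (c p).2; omega
        · simp only [y, if_pos h1, h3]
      · refine ⟨p, Finset.mem_filter.2 ⟨Finset.mem_univ _, Or.inr ⟨h1, h2, ?_⟩⟩, ?_⟩
        · have := (c p).2; omega
        · simp only [y, if_neg (hdisj _ h1), h3]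
    choose q hq1 hq2 using this
    exact ⟨q, Fintype.mem_piFinset.2 hq1, hq2⟩
  refine hmono.trans ((pr_exists_le _ _).trans ?_)
  -- A left slot determines the tail of its arc and a right slot the head, so different arcs use
  -- different, hence independent, choices.
  have hinj : ∀ q ∈ Fintype.piFinset Q, Function.Injective q := by
    intro q hq i j hij
    have hi := (Finset.mem_filter.1 (Fintype.mem_piFinset.1 hq i)).2
    have hj := (Finset.mem_filter.1 (Fintype.mem_piFinset.1 hq j)).2
    rw [← hij] at hj
    rcases hi with ⟨a1, a2, a3⟩ | ⟨a1, a2, a3⟩ <;> rcases hj with ⟨b1, b2, b3⟩ | ⟨b1, b2, b3⟩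
    · exact hx (Fin.ext (a2.symm.trans b2))
    · exact absurd a1 (hdisj _ b1)
    · exact absurd b1 (hdisj _ a1)
    · exact τ.injective (hx (Fin.ext (a2.symm.trans b2)))
  refine (Finset.sum_le_sum fun q hq => pr_values_le q (hinj q hq) fun i => y i (q i)).trans ?_
  rw [← Finset.prod_univ_sum Q fun _ p => (1 : ℝ) / (p.1.val + 1)]
  have hQcard : ∀ i, (Q i).card ≤ 12 := by
    intro i
    have hsub : Q i ⊆ (leftIdx ∪ rightIdx).biUnion fun l =>
        Finset.univ.filter fun p => p.2 = l ∧ p ∈ Q i := by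
      intro p hp
      refine Finset.mem_biUnion.2 ⟨p.2, ?_, by simp [hp]⟩
      rcases (Finset.mem_filter.1 hp).2 with h | h
      · exact Finset.mem_union_left _ h.1
      · exact Finset.mem_union_right _ h.1
    refine (Finset.card_le_card hsub).trans ((Finset.card_biUnion_le_card_mul _ _ 1 ?_).trans ?_)
    · intro l hl
      rw [Finset.card_le_one]
      intro p hp p' hp'
      obtain ⟨e1, hp⟩ := (Finset.mem_filter.1 hp).2
      obtain ⟨e2, hp'⟩ := (Finset.mem_filter.1 hp').2
      have hl' : p.2 = p'.2 := e1.trans e2.symm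
      refine Prod.ext (Fin.ext ?_) hl'
      rcases (Finset.mem_filter.1 hp).2 with ⟨a1, a2, a3⟩ | ⟨a1, a2, a3⟩ <;>
        rcases (Finset.mem_filter.1 hp').2 with ⟨b1, b2, b3⟩ | ⟨b1, b2, b3⟩
      · omega
      · rw [hl'] at a1; exact absurd a1 (hdisj _ b1)
      · rw [hl'] at a1; exact absurd b1 (hdisj _ a1)
      · omega
    · decide
  have hfac : ∀ i, ∑ p ∈ Q i, (1 : ℝ) / (p.1.val + 1) ≤
      24 * (1 / √((x i).val + 1) * (1 / √((x (τ i)).val + 1))) := by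
    intro i
    have : ∀ p ∈ Q i, (1 : ℝ) / (p.1.val + 1) ≤
        2 * (1 / √((x i).val + 1) * (1 / √((x (τ i)).val + 1))) := by
      intro p hp
      have h := (Finset.mem_filter.1 hp).2
      apply one_div_max_le (by positivity) (by positivity)
      · exact_mod_cast (by omega : (x i).val + 1 ≤ 2 * (p.1.val + 1))
      · exact_mod_cast (by omega : (x (τ i)).val + 1 ≤ 2 * (p.1.val + 1))
    refine (Finset.sum_le_sum this).trans ?_
    rw [Finset.sum_const, nsmul_eq_mul]
    have h12 : ((Q i).card : ℝ) ≤ 12 := by exact_mod_cast hQcard i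
    have h0 : 0 ≤ 1 / √(((x i).val : ℝ) + 1) * (1 / √(((x (τ i)).val : ℝ) + 1)) := by positivity
    nlinarith
  refine (Finset.prod_le_prod (fun i _ => Finset.sum_nonneg fun _ _ => by positivity)
    fun i _ => hfac i).trans (le_of_eq ?_)
  rw [Finset.prod_mul_distrib, Finset.prod_mul_distrib, Finset.prod_mul_distrib]
  congr 1
  rw [Equiv.prod_comp τ fun i => 1 / √(((x i).val : ℝ) + 1), ← Finset.prod_mul_distrib]
  refine Finset.prod_congr rfl fun i _ => ?_
  rw [one_div_mul_one_div, Real.mul_self_sqrt (by positivity)]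

/-- The sequence `x` runs around a cycle of arcs. -/
def ArcCycle {n : ℕ} (c : Choices n 13) {k : ℕ} (x : Fin (k + 1) → Fin n) : Prop :=
  Function.Injective x ∧ ∀ i, Arc c (x i) (x (finRotate (k + 1) i))

open Classical in
-- The product bound summed over all sequences is a power of the harmonic sum; Markov's inequality
-- does the rest.
lemma pr_card_arcCycle_ge_le {n : ℕ} (k : ℕ) {a : ℝ} (ha : 0 < a) :
    pr (fun c : Choices n 13 =>
      a ≤ (Finset.univ.filter fun x : Fin (k + 1) → Fin n => ArcCycle c x).card) ≤
      (24 * ∑ v : Fin n, (1 : ℝ) / (v.val + 1)) ^ (k + 1) / a := by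
  refine (pr_le_card_filter Finset.univ (fun x c => ArcCycle c x) ha).trans ?_
  gcongr
  have h : ∀ x : Fin (k + 1) → Fin n, pr (fun c : Choices n 13 => ArcCycle c x) ≤
      ∏ i, (24 : ℝ) * (1 / ((x i).val + 1)) := by
    intro x
    by_cases hx : Function.Injective x
    · exact (pr_mono fun c h => h.2).trans (pr_arcs_le _ x hx)
    · simp only [ArcCycle, hx, false_and, pr_eq, Finset.filter_false]
      simp
      positivity
  refine (Finset.sum_le_sum fun x _ => h x).trans (le_of_eq ?_)
  rw [Finset.mul_sum, ← Fin.prod_const, Finset.prod_univ_sum, Fintype.piFinset_univ]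

end shortCycles

end UniformAttachment

namespace UniformAttachment

/-! ### The graph of the exposed choices -/

section graphOn

/-- The graph formed by the choices in the slots of `D`. -/
def graphOn {n k : ℕ} (D : Finset (Fin (n - 1) × Fin k)) (c : Choices n k) : SimpleGraph (Fin n) :=
  SimpleGraph.fromRel fun v u => ∃ p ∈ D, v.val = p.1.val + 1 ∧ u.val = (c p).val

variable {n k : ℕ} {D : Finset (Fin (n - 1) × Fin k)} {c : Choices n k}

lemma graphOn_adj_of_mem {p : Fin (n - 1) × Fin k} (hp : p ∈ D) {v u : Fin n}
    (hv : v.val = p.1.val + 1) (hu : u.val = (c p).val) : (graphOn D c).Adj v u := by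
  rw [graphOn, SimpleGraph.fromRel_adj]
  refine ⟨?_, Or.inl ⟨p, hp, hv, hu⟩⟩
  rintro rfl
  have := (c p).2
  omega

lemma graphOn_le {D' : Finset (Fin (n - 1) × Fin k)} {c' : Choices n k} (hD : D ⊆ D')
    (hc : ∀ p ∈ D, c' p = c p) : graphOn D c ≤ graphOn D' c' := by
  intro v u h
  rw [graphOn, SimpleGraph.fromRel_adj] at h ⊢
  refine ⟨h.1, h.2.imp ?_ ?_⟩ <;>
  · rintro ⟨p, hp, h1, h2⟩
    exact ⟨p, hD hp, h1, by rw [h2, hc p hp]⟩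

lemma graphOn_le_graph : graphOn D c ≤ graph n k c := by
  intro v u h
  rw [graphOn, SimpleGraph.fromRel_adj] at h
  rw [graph, SimpleGraph.fromRel_adj]
  refine ⟨h.1, h.2.imp ?_ ?_⟩ <;>
  · rintro ⟨p, hp, h1, h2⟩
    exact ⟨p, h1, h2⟩

lemma val_choice_lt (c : Choices n k) (p : Fin (n - 1) × Fin k) : (c p).val < n := by
  have h1 := (c p).2
  have h2 := p.1.2
  omega

/-- The slots of the first twelve choices. -/
def baseSlots (n : ℕ) : Finset (Fin (n - 1) × Fin 13) := Finset.univ.filter fun p => p.2 ∈ baseIdx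

lemma expands_of_not_expansionFails {c : Choices n 13} (h : ¬ ExpansionFails n c) :
    Expands (graphOn (baseSlots n) c) (n / 50) := by
  intro s w hs hcard hsw hclosed
  by_contra hlt
  push Not at hlt
  have hs0 := hs.card_pos
  -- A closed neighbourhood that is too small is padded to exactly `3|s|` vertices; its complement
  -- serves as `T`.
  obtain ⟨w', hw, -, hw'⟩ := Finset.exists_subsuperset_card_eq (Finset.subset_univ w) hlt
    (by rw [Finset.card_univ, Fintype.card_fin]; omega)
  apply h
  refine ⟨s.map Fin.valEmbedding, w'ᶜ.map Fin.valEmbedding, ?_, ?_, ?_, ?_, ?_, ?_, ?_⟩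
  · intro x hx
    obtain ⟨y, -, rfl⟩ := Finset.mem_map.1 hx
    exact Finset.mem_range.2 y.2
  · intro x hx
    obtain ⟨y, -, rfl⟩ := Finset.mem_map.1 hx
    exact Finset.mem_range.2 y.2
  · rw [Finset.disjoint_map]
    exact Finset.disjoint_left.2 fun x hx hx' => Finset.mem_compl.1 hx' (hw (hsw hx))
  · rwa [Finset.card_map]
  · rw [Finset.card_map]; omega
  · rw [Finset.card_map, Finset.card_map, Finset.card_compl, Fintype.card_fin]; omega
  · intro p
    have hadj : p.2 ∈ baseIdx → (graphOn (baseSlots n) c).Adj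
        ⟨p.1.val + 1, by have := p.1.2; omega⟩ ⟨(c p).val, val_choice_lt c p⟩ := fun hp =>
      graphOn_adj_of_mem (p := p) (Finset.mem_filter.2 ⟨Finset.mem_univ _, hp⟩) rfl rfl
    constructor
    · intro hp h1 h2
      obtain ⟨y, hy, e1⟩ := Finset.mem_map.1 h1
      obtain ⟨z, hz, e2⟩ := Finset.mem_map.1 h2
      have hy' : (⟨p.1.val + 1, by have := p.1.2; omega⟩ : Fin n) = y := Fin.ext e1.symm
      have hz' : (⟨(c p).val, val_choice_lt c p⟩ : Fin n) = z := Fin.ext e2.symm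
      rw [hy', hz'] at hadj
      exact Finset.mem_compl.1 hz (hw (hclosed _ hy _ (hadj hp)))
    · intro hp h1 h2
      obtain ⟨y, hy, e1⟩ := Finset.mem_map.1 h1
      obtain ⟨z, hz, e2⟩ := Finset.mem_map.1 h2
      have hy' : (⟨p.1.val + 1, by have := p.1.2; omega⟩ : Fin n) = y := Fin.ext e1.symm
      have hz' : (⟨(c p).val, val_choice_lt c p⟩ : Fin n) = z := Fin.ext e2.symm
      rw [hy', hz'] at hadj
      exact Finset.mem_compl.1 hy (hw (hclosed _ hz _ (hadj hp).symm))

lemma graphOn_adj_of_arc {c : Choices n 13} (v u : Fin n) (h : Arc c v.val u.val) :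
    (graphOn (baseSlots n) c).Adj v u := by
  have hl : ∀ l, l ∈ leftIdx → l ∈ baseIdx := by decide
  have hr : ∀ l, l ∈ rightIdx → l ∈ baseIdx := by decide
  rcases h with ⟨p, h1, h2, h3⟩ | ⟨p, h1, h2, h3⟩
  · exact graphOn_adj_of_mem (p := p) (Finset.mem_filter.2 ⟨Finset.mem_univ _, hl _ h1⟩) h2.symm h3.symm
  · exact (graphOn_adj_of_mem (p := p) (Finset.mem_filter.2 ⟨Finset.mem_univ _, hr _ h1⟩) h2.symm
      h3.symm).symm

end graphOn

/-! ### A near-perfect matching and its short cycles -/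

section nearPerfectMatching
open Classical

/-- Hall's theorem with `d` dummy right vertices adjacent to everything: at most `d` vertices are
matched to dummies, and the rest form a partial injection along arcs that extends to a permutation.
-/
lemma exists_perm_of_not_matchingFails {n d : ℕ} {ε : ℝ} {c : Choices n 13}
    (h : ¬ MatchingFails n ε c) (hd : ε * n ≤ d) (h2d : 2 * d ≤ n) :
    ∃ π : Equiv.Perm (Fin n),
      (Finset.univ.filter fun v => ¬ Arc c v.val (π v).val).card ≤ d := by
  let N : Fin n → Finset (Fin n) := fun v => Finset.univ.filter fun u => Arc c v.val u.val
  let t : Fin n → Finset (Fin n ⊕ Fin d) := fun v => (N v).disjSum Finset.univ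
  have hall : ∀ S : Finset (Fin n), S.card ≤ (S.biUnion t).card := by
    intro S
    rcases S.eq_empty_or_nonempty with rfl | ⟨v₀, hv₀⟩
    · simp
    have hb : S.biUnion t = (S.biUnion N).disjSum Finset.univ := by
      ext x
      rcases x with x | x
      · simp [t]
      · simp only [t, Finset.mem_biUnion, Finset.inr_mem_disjSum, Finset.mem_univ, and_true, iff_true]
        exact ⟨v₀, hv₀⟩
    rw [hb, Finset.card_disjSum, Finset.card_univ, Fintype.card_fin]
    by_contra hlt
    push Not at hlt
    have hSn : S.card ≤ n := by simpa using Finset.card_le_univ S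
    have hNn : (S.biUnion N).card ≤ n := by simpa using Finset.card_le_univ (S.biUnion N)
    have hT : (S.biUnion N)ᶜ.card = n - (S.biUnion N).card := by
      rw [Finset.card_compl, Fintype.card_fin]
    -- A Hall violator satisfies `|S| > |N(S)| + d`. Trimming `S` and the complement of `N(S)` to
    -- total size exactly `n` leaves at least `d` vertices in each.
    obtain ⟨S', hS', hS'c⟩ := Finset.exists_subset_card_eq (s := S) (n := min S.card (n - d))
      (min_le_left _ _)
    obtain ⟨T', hT', hT'c⟩ := Finset.exists_subset_card_eq (s := (S.biUnion N)ᶜ)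
      (n := n - min S.card (n - d)) (by omega)
    apply h
    refine ⟨S'.map Fin.valEmbedding, T'.map Fin.valEmbedding, ?_, ?_, ?_, ?_, ?_, ?_⟩
    · intro x hx
      obtain ⟨y, -, rfl⟩ := Finset.mem_map.1 hx
      exact Finset.mem_range.2 y.2
    · intro x hx
      obtain ⟨y, -, rfl⟩ := Finset.mem_map.1 hx
      exact Finset.mem_range.2 y.2
    · rw [Finset.card_map, Finset.card_map]; omega
    · rw [Finset.card_map, hS'c]
      exact hd.trans (by exact_mod_cast (by omega : d ≤ min S.card (n - d)))
    · rw [Finset.card_map, hT'c]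
      exact hd.trans (by exact_mod_cast (by omega : d ≤ n - min S.card (n - d)))
    · have hno : ∀ v ∈ S', ∀ u ∈ T', ¬ Arc c v.val u.val := by
        intro v hv u hu ha
        refine Finset.mem_compl.1 (hT' hu) (Finset.mem_biUnion.2 ⟨v, hS' hv, ?_⟩)
        exact Finset.mem_filter.2 ⟨Finset.mem_univ _, ha⟩
      intro p
      constructor
      · intro hp h1 h2
        obtain ⟨y, hy, e1⟩ := Finset.mem_map.1 h1
        obtain ⟨z, hz, e2⟩ := Finset.mem_map.1 h2
        exact hno y hy z hz (Or.inl ⟨p, hp, e1.symm, e2.symm⟩)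
      · intro hp h1 h2
        obtain ⟨y, hy, e1⟩ := Finset.mem_map.1 h1
        obtain ⟨z, hz, e2⟩ := Finset.mem_map.1 h2
        exact hno z hz y hy (Or.inr ⟨p, hp, e1.symm, e2.symm⟩)
  obtain ⟨f, hf, hft⟩ := (Finset.all_card_le_biUnion_card_iff_exists_injective t).1 hall
  let g : Fin n → Fin n := fun v => Sum.elim id (fun _ => v) (f v)
  let s : Finset (Fin n) := Finset.univ.filter fun v => ∃ u, f v = Sum.inl u
  have hgs : Set.InjOn g s := by
    intro a ha b hb hab
    obtain ⟨u, hu⟩ := (Finset.mem_filter.1 ha).2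
    obtain ⟨w, hw⟩ := (Finset.mem_filter.1 hb).2
    simp only [g, hu, hw, Sum.elim_inl, id] at hab
    exact hf (by rw [hu, hw, hab])
  obtain ⟨e, he⟩ := Finset.exists_equiv_extend_of_card_eq (t := (Finset.univ : Finset (Fin n)))
    (by simp) (Finset.subset_univ (s.image g)) hgs
  refine ⟨e.trans (Equiv.subtypeUnivEquiv fun x => Finset.mem_univ x), ?_⟩
  have hsub : (Finset.univ.filter fun v => ¬ Arc c v.val
      ((e.trans (Equiv.subtypeUnivEquiv fun x => Finset.mem_univ x)) v).val) ⊆ sᶜ := by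
    intro v hv
    refine Finset.mem_compl.2 fun hvs => (Finset.mem_filter.1 hv).2 ?_
    obtain ⟨u, hu⟩ := (Finset.mem_filter.1 hvs).2
    have h1 := he v hvs
    have h2 := hft v
    simp only [t, hu, Finset.inl_mem_disjSum, N, Finset.mem_filter, Finset.mem_univ, true_and] at h2
    rw [Equiv.trans_apply, Equiv.subtypeUnivEquiv_apply, h1]
    simpa only [g, hu, Sum.elim_inl, id] using h2
  refine (Finset.card_le_card hsub).trans ?_
  have hmaps : ∀ v ∈ sᶜ, f v ∈ (Finset.univ : Finset (Fin d)).map Function.Embedding.inr := by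
    intro v hv
    rcases hfv : f v with u | u
    · exact absurd (Finset.mem_filter.2 ⟨Finset.mem_univ _, u, hfv⟩) (Finset.mem_compl.1 hv)
    · simp
  have := Finset.card_le_card_of_injOn f hmaps hf.injOn
  simpa using this

/-- A vertex is recovered as the first entry of the sequence that runs once around its orbit. -/
lemma card_short_arc_orbits_le {n : ℕ} (c : Choices n 13) (π : Equiv.Perm (Fin n)) (L : ℕ) :
    (Finset.univ.filter fun v => Function.minimalPeriod π v ≤ L ∧
      ∀ i, Arc c (π^[i] v).val (π (π^[i] v)).val).card ≤
    ∑ k ∈ Finset.range L,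
      (Finset.univ.filter fun x : Fin (k + 1) → Fin n => ArcCycle c x).card := by
  have hsub : (Finset.univ.filter fun v => Function.minimalPeriod π v ≤ L ∧
      ∀ i, Arc c (π^[i] v).val (π (π^[i] v)).val) ⊆ (Finset.range L).biUnion fun k =>
      Finset.univ.filter fun v => Function.minimalPeriod π v = k + 1 ∧
      ∀ i, Arc c (π^[i] v).val (π (π^[i] v)).val := by
    intro v hv
    obtain ⟨-, h1, h2⟩ := Finset.mem_filter.1 hv
    have hp := minimalPeriod_perm_pos π v
    exact Finset.mem_biUnion.2 ⟨Function.minimalPeriod π v - 1, Finset.mem_range.2 (by omega),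
      Finset.mem_filter.2 ⟨Finset.mem_univ _, by omega, h2⟩⟩
  refine (Finset.card_le_card hsub).trans (Finset.card_biUnion_le.trans ?_)
  refine Finset.sum_le_sum fun k _ => ?_
  refine Finset.card_le_card_of_injOn (fun v i => π^[i.val] v) ?_ ?_
  · intro v hv
    obtain ⟨-, h1, h2⟩ := Finset.mem_filter.1 hv
    refine Finset.mem_filter.2 ⟨Finset.mem_univ _, ?_, ?_⟩
    · intro i j hij
      exact Fin.ext (Function.iterate_injOn_Iio_minimalPeriod (Set.mem_Iio.2 (i.2.trans_eq h1.symm))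
        (Set.mem_Iio.2 (j.2.trans_eq h1.symm)) hij)
    · intro i
      have : π^[(finRotate (k + 1) i).val] v = π (π^[i.val] v) := by
        rw [← Function.iterate_succ_apply' π]
        rcases eq_or_ne i (Fin.last k) with rfl | hi
        · have h3 := Function.iterate_minimalPeriod (f := π) (x := v)
          rw [h1] at h3
          rw [finRotate_last, Fin.val_last, Nat.succ_eq_add_one, h3]
          rfl
        · rw [coe_finRotate_of_ne_last hi]
      show Arc c (π^[i.val] v).val (π^[(finRotate (k + 1) i).val] v).val
      rw [this]
      exact h2 i.val
  · intro v _ w _ hvw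
    exact congrFun hvw 0

end nearPerfectMatching

/-! ### Removing gaps with the thirteenth choices -/

section sprinkling
open Classical

lemma Linked.mono {V : Type*} {G H : SimpleGraph V} (h : G ≤ H) {b : ℕ} {x y : V}
    (hl : Linked G b x y) : Linked H b x y := by
  obtain ⟨l, h1, h2, h3⟩ := hl
  exact ⟨l, h1, (gaps_mono h l).trans h2, h3⟩

/-- A dense symmetric relation on `Fin n` has a vertex outside a small set that is related to many
smaller vertices. -/
lemma exists_many_smaller {n : ℕ} (hn : 5000 ≤ n) {R : Fin n → Fin n → Prop}
    (hsymm : ∀ u v, R u v → R v u) (A X : Finset (Fin n)) (hA : n / 50 < A.card)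
    (hR : ∀ z ∈ A, n / 50 < (Finset.univ.filter (R z)).card) (hX : 20000 * X.card ≤ n) :
    ∃ v ∉ X, n ≤ 20000 * (Finset.univ.filter fun u => u < v ∧ R v u).card := by
  -- Otherwise count ordered related pairs. There are more than `n²/2500`, yet at most `n` plus
  -- twice the pairs counted at their larger end. Vertices in `X` and outside `X` contribute at most
  -- `n²/20000` each to the latter, and `n ≤ n²/5000`.
  by_contra! hcon
  set g : Fin n → ℕ := fun v => (Finset.univ.filter fun u => u < v ∧ R v u).card with hg
  have h1 : (n / 50 + 1) * (n / 50 + 1) ≤ ∑ v, (Finset.univ.filter (R v)).card := by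
    calc (n / 50 + 1) * (n / 50 + 1) ≤ A.card * (n / 50 + 1) := Nat.mul_le_mul_right _ hA
      _ = ∑ v ∈ A, (n / 50 + 1) := by rw [Finset.sum_const, smul_eq_mul]
      _ ≤ ∑ v ∈ A, (Finset.univ.filter (R v)).card := Finset.sum_le_sum fun v hv => hR v hv
      _ ≤ _ := Finset.sum_le_sum_of_subset (Finset.subset_univ _)
  have h2 : ∑ v, (Finset.univ.filter (R v)).card ≤ 2 * (∑ v, g v) + n := by
    have e1 : ∑ v, (Finset.univ.filter (R v)).card ≤
        ∑ v : Fin n, ∑ u : Fin n, ((if u < v ∧ R v u then 1 else 0) +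
          (if v < u ∧ R u v then 1 else 0) + if u = v then 1 else 0) := by
      refine Finset.sum_le_sum fun v _ => ?_
      rw [Finset.card_filter]
      refine Finset.sum_le_sum fun u _ => ?_
      by_cases hvu : R v u
      · have := hsymm _ _ hvu
        rcases lt_trichotomy u v with h | h | h
        · simp only [h, hvu, and_self, if_true]; omega
        · simp only [h, if_true]; split_ifs <;> omega
        · simp only [h, hvu, this, and_self, if_true]; omega
      · simp [hvu]
    refine e1.trans (le_of_eq ?_)
    simp only [Finset.sum_add_distrib]
    have e2 : ∑ v : Fin n, ∑ u : Fin n, (if v < u ∧ R u v then 1 else 0) = ∑ v, g v := by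
      rw [Finset.sum_comm]
      exact Finset.sum_congr rfl fun v _ => (Finset.card_filter _ _).symm
    have e3 : ∑ v : Fin n, ∑ u : Fin n, (if u < v ∧ R v u then 1 else 0) = ∑ v, g v :=
      Finset.sum_congr rfl fun v _ => (Finset.card_filter _ _).symm
    rw [e2, e3]
    simp
    ring
  have h3 : 20000 * ∑ v, g v ≤ 20000 * X.card * n + n * n := by
    rw [← Finset.sum_add_sum_compl X, mul_add]
    refine add_le_add ?_ ?_
    · rw [mul_assoc]
      gcongr
      rw [← smul_eq_mul, ← Finset.sum_const]
      refine Finset.sum_le_sum fun v _ => ?_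
      simpa using Finset.card_le_univ (Finset.univ.filter fun u => u < v ∧ R v u)
    · rw [Finset.mul_sum]
      calc ∑ v ∈ Xᶜ, 20000 * g v ≤ ∑ v ∈ Xᶜ, n :=
            Finset.sum_le_sum fun v hv => (hcon v (Finset.mem_compl.1 hv)).le
        _ ≤ n * n := by
            rw [Finset.sum_const, smul_eq_mul]
            gcongr
            simpa using Finset.card_le_univ Xᶜ
  have h4 : n < 50 * (n / 50 + 1) := by omega
  have h5 : 20000 * X.card * n ≤ n * n := Nat.mul_le_mul_right _ hX
  have h6 : n * n < 2500 * ((n / 50 + 1) * (n / 50 + 1)) := by nlinarith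
  nlinarith

/-- The exposed graph is an expander that is Hamiltonian if `m = 0` and otherwise has an ordering
with fewer than `m` gaps. -/
def SprinkleState (n : ℕ) (D : Finset (Fin (n - 1) × Fin 13)) (c : Choices n 13) (m : ℕ) : Prop :=
  baseSlots n ⊆ D ∧ Expands (graphOn D c) (n / 50) ∧
    ((m = 0 ∧ (graphOn D c).IsHamiltonian) ∨
      ∃ b, m = b + 1 ∧ ∃ l, IsOrdering l ∧ gaps (graphOn D c) l ≤ b)

lemma exists_ends {V : Type*} {G : SimpleGraph V} {l : List V} (hl : l ≠ []) (ho : IsOrdering l)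
    {b : ℕ} (hb : gaps G l ≤ b) : ∃ x y, Linked G b x y :=
  ⟨l.head hl, l.getLast hl, l, ho, hb, List.head?_eq_some_head hl, List.getLast?_eq_some_getLast hl⟩

/-- Fewer than `n/20000` thirteenth choices are exposed, so a vertex `v` with a fresh one has many
smaller linked partners. Choosing any of them closes an ordering; `v` depends only on exposed
choices. -/
lemma SprinkleState.exists_step {n : ℕ} (hn : 5000 ≤ n) {D : Finset (Fin (n - 1) × Fin 13)}
    {c : Choices n 13} {m : ℕ} (hD : D.card < (baseSlots n).card + n / 20000)
    (h : SprinkleState n D c (m + 1)) :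
    ∃ p ∉ D, (∀ v, SprinkleState n (insert p D) (Function.update c p v) (m + 1)) ∧
      (1 / 20000 : ℝ) * Fintype.card (Fin (p.1.val + 1)) ≤
        (Finset.univ.filter fun v => SprinkleState n (insert p D) (Function.update c p v) m).card := by
  obtain ⟨hbase, hexp, ⟨h0, -⟩ | ⟨b, hb, l, ho, hl⟩⟩ := h
  · omega
  obtain rfl : m = b := by omega
  have hlne : l ≠ [] := by
    rintro rfl
    simpa using ho.2 ⟨0, by omega⟩
  obtain ⟨x, y, hxy⟩ := exists_ends hlne ho hl
  let X : Finset (Fin n) := Finset.univ.filter fun v =>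
    ∃ p ∈ D \ baseSlots n, v.val = p.1.val + 1
  have hXcard : X.card ≤ (D \ baseSlots n).card := by
    have : X ⊆ (D \ baseSlots n).image fun p => (⟨p.1.val + 1, by have := p.1.2; omega⟩ : Fin n) := by
      intro v hv
      obtain ⟨-, p, hp, hv⟩ := Finset.mem_filter.1 hv
      exact Finset.mem_image.2 ⟨p, hp, Fin.ext hv.symm⟩
    exact (Finset.card_le_card this).trans Finset.card_image_le
  rw [Finset.card_sdiff_of_subset hbase] at hXcard
  have hlinked : ∀ z, Linked (graphOn D c) m x z →
      n / 50 < (Finset.univ.filter (Linked (graphOn D c) m z)).card :=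
    fun z hz => hexp.card_linked hz.symm
  obtain ⟨v, hvX, hv⟩ := exists_many_smaller hn (R := Linked (graphOn D c) m)
    (fun u v h => h.symm) (Finset.univ.filter (Linked (graphOn D c) m x)) X
    (hexp.card_linked hxy) (fun z hz => hlinked z (Finset.mem_filter.1 hz).2) (by omega)
  have hv0 : v.val ≠ 0 := by
    intro h0
    have : (Finset.univ.filter fun u => u < v ∧ Linked (graphOn D c) m v u) = ∅ := by
      rw [Finset.filter_eq_empty_iff]
      rintro u - ⟨hu, -⟩
      rw [Fin.lt_def] at hu
      omega
    rw [this, Finset.card_empty] at hv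
    omega
  set p : Fin (n - 1) × Fin 13 := (⟨v.val - 1, by have := v.2; omega⟩, ⟨12, by norm_num⟩) with hp
  have hp1 : p.1.val + 1 = v.val := by simp only [hp]; omega
  have hpD : p ∉ D := by
    intro hmem
    refine hvX (Finset.mem_filter.2 ⟨Finset.mem_univ _, p, Finset.mem_sdiff.2 ⟨hmem, ?_⟩, hp1.symm⟩)
    intro hmem'
    have := (Finset.mem_filter.1 hmem').2
    simp [hp, baseIdx] at this
  have hle : ∀ w, graphOn D c ≤ graphOn (insert p D) (Function.update c p w) := fun w =>
    graphOn_le (Finset.subset_insert _ _) fun q hq => by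
      rw [Function.update_of_ne]; rintro rfl; exact hpD hq
  have hbase' : baseSlots n ⊆ insert p D := hbase.trans (Finset.subset_insert _ _)
  refine ⟨p, hpD, fun w => ⟨hbase', hexp.mono (hle w), Or.inr ⟨m, rfl, l, ho,
    (gaps_mono (hle w) l).trans hl⟩⟩, ?_⟩
  have hcard : (Finset.univ.filter fun u => u < v ∧ Linked (graphOn D c) m v u).card ≤
      (Finset.univ.filter fun w => SprinkleState n (insert p D) (Function.update c p w) m).card := by
    -- The reduction in `Fin.ofNat` does nothing here, since `u < v`.
    refine Finset.card_le_card_of_injOn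
      (fun u => Fin.ofNat (p.1.val + 1) u.val) ?_ ?_
    · intro u hu
      obtain ⟨-, huv, hL⟩ := Finset.mem_filter.1 hu
      rw [Fin.lt_def] at huv
      refine Finset.mem_filter.2 ⟨Finset.mem_univ _, hbase', hexp.mono (hle _), ?_⟩
      set w : Fin (p.1.val + 1) := Fin.ofNat (p.1.val + 1) u.val with hw
      have hwu : w.val = u.val := by
        rw [hw, Fin.val_ofNat, Nat.mod_eq_of_lt (by omega)]
      have hadj : (graphOn (insert p D) (Function.update c p w)).Adj v u :=
        graphOn_adj_of_mem (Finset.mem_insert_self _ _) hp1.symm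
          (by rw [Function.update_self, hwu])
      have hL' := hL.mono (hle w)
      cases m with
      | zero =>
        obtain ⟨l', ho', hl', hx, hy⟩ := hL'
        exact Or.inl ⟨rfl, ho'.isHamiltonian (by rw [Fintype.card_fin]; omega)
          (Nat.le_zero.1 hl') hx hy hadj.symm⟩
      | succ b => exact Or.inr ⟨b, rfl, hL'.close hadj⟩
    · intro u hu u' hu' huu
      have h1 := (Finset.mem_filter.1 hu).2.1
      have h2 := (Finset.mem_filter.1 hu').2.1
      rw [Fin.lt_def] at h1 h2
      have := congrArg Fin.val huu
      simp only [Fin.val_ofNat] at this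
      rw [Nat.mod_eq_of_lt (by omega), Nat.mod_eq_of_lt (by omega)] at this
      exact Fin.ext this
  rw [Fintype.card_fin]
  have h1 : (n : ℝ) ≤ 20000 *
      (Finset.univ.filter fun u => u < v ∧ Linked (graphOn D c) m v u).card := by exact_mod_cast hv
  have h2 : ((Finset.univ.filter fun u => u < v ∧ Linked (graphOn D c) m v u).card : ℝ) ≤
    (Finset.univ.filter fun w => SprinkleState n (insert p D) (Function.update c p w) m).card := by
    exact_mod_cast hcard
  have h3 : ((p.1.val + 1 : ℕ) : ℝ) ≤ n := by exact_mod_cast hp1.trans_le v.2.le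
  linarith

lemma pr_sprinkle_fail_le {n : ℕ} (hn : 5000 ≤ n) (m : ℕ) :
    pr (fun c => SprinkleState n (baseSlots n) c m ∧ ¬ (graph n 13 c).IsHamiltonian) ≤
      2 ^ m * (1 - 1 / 40000) ^ (n / 20000) := by
  have h := pr_fail_le (SprinkleState n) (fun c => ¬ (graph n 13 c).IsHamiltonian) (1 / 20000)
    ((baseSlots n).card + n / 20000) (by norm_num)
    (by
      intro D c c' m hcc h
      have e : graphOn D c' = graphOn D c := le_antisymm
        (graphOn_le subset_rfl fun p hp => (hcc p hp).symm) (graphOn_le subset_rfl hcc)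
      unfold SprinkleState at h ⊢
      rwa [e])
    (by
      rintro D c ⟨-, -, ⟨-, h⟩ | ⟨b, hb, -⟩⟩
      · exact not_not.2 (h.mono graphOn_le_graph)
      · omega)
    (fun D c m hD h => h.exists_step hn hD) (n / 20000) m (baseSlots n) le_rfl
  refine h.trans (le_of_eq ?_)
  norm_num

end sprinkling

end UniformAttachment

namespace UniformAttachment

/-! ### Choice of constants and the limit -/

section conclusion
open Classical

lemma sprinkleState_of_not_fails {n L d B : ℕ} {ε a : ℝ} {c : Choices n 13} (hL : 0 < L)
    (hE : ¬ ExpansionFails n c) (hM : ¬ MatchingFails n ε c) (hd : ε * n ≤ d) (h2d : 2 * d ≤ n)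
    (hC : ∀ k < L, ((Finset.univ.filter fun x : Fin (k + 1) → Fin n => ArcCycle c x).card : ℝ) ≤ a)
    (hB : (L + 1) * d + L * a + n / L ≤ (B : ℝ) + 1 / 2) :
    SprinkleState n (baseSlots n) c (B + 1) := by
  obtain ⟨π, hπ⟩ := exists_perm_of_not_matchingFails hM hd h2d
  obtain ⟨l, ho, hl⟩ := exists_ordering_of_perm (graphOn (baseSlots n) c) π
    (r := fun v u => Arc c v.val u.val) graphOn_adj_of_arc hL
  refine ⟨subset_rfl, expands_of_not_expansionFails hE, Or.inr ⟨B, rfl, l, ho, ?_⟩⟩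
  have h1 : ((Finset.univ.filter fun v => Function.minimalPeriod π v ≤ L ∧
      ∀ i, Arc c (π^[i] v).val (π (π^[i] v)).val).card : ℝ) ≤ L * a := by
    have h2 : ((Finset.univ.filter fun v => Function.minimalPeriod π v ≤ L ∧
        ∀ i, Arc c (π^[i] v).val (π (π^[i] v)).val).card : ℝ) ≤ ∑ k ∈ Finset.range L,
        ((Finset.univ.filter fun x : Fin (k + 1) → Fin n => ArcCycle c x).card : ℝ) := by
      exact_mod_cast card_short_arc_orbits_le c π L
    refine h2.trans ((Finset.sum_le_sum fun k hk => hC k (Finset.mem_range.1 hk)).trans ?_)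
    rw [Finset.sum_const, Finset.card_range, nsmul_eq_mul]
  have h3 : ((L : ℝ) + 1) * (Finset.univ.filter fun v => ¬ Arc c v.val (π v).val).card ≤
      (L + 1) * d := by
    gcongr
  rw [Fintype.card_fin] at hl
  -- The slack `1/2` gives a strict bound, which suffices as the number of gaps is an integer.
  have h4 : (gaps (graphOn (baseSlots n) c) l : ℝ) < B + 1 := by linarith
  exact Nat.lt_succ_iff.1 (by exact_mod_cast h4)

lemma pr_not_isHamiltonian_le {n L d B : ℕ} {ε a : ℝ} (hn : 5000 ≤ n) (hL : 0 < L) (ha : 0 < a)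
    (hd : ε * n ≤ d) (h2d : 2 * d ≤ n) (hB : (L + 1) * d + L * a + n / L ≤ (B : ℝ) + 1 / 2) :
    pr (fun c => ¬ (graph n 13 c).IsHamiltonian) ≤ pr (ExpansionFails n) + pr (MatchingFails n ε) +
      (∑ k ∈ Finset.range L, (24 * ∑ v : Fin n, (1 : ℝ) / (v.val + 1)) ^ (k + 1) / a) +
      2 ^ (B + 1) * (1 - 1 / 40000) ^ (n / 20000) := by
  have h : ∀ c, ¬ (graph n 13 c).IsHamiltonian →
      ((ExpansionFails n c ∨ MatchingFails n ε c) ∨ ∃ k ∈ Finset.range L,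
        a ≤ (Finset.univ.filter fun x : Fin (k + 1) → Fin n => ArcCycle c x).card) ∨
      (SprinkleState n (baseSlots n) c (B + 1) ∧ ¬ (graph n 13 c).IsHamiltonian) := by
    intro c hc
    by_contra! hcon
    obtain ⟨⟨⟨h1, h2⟩, h3⟩, h4⟩ := hcon
    exact hc (h4 (sprinkleState_of_not_fails hL h1 h2 hd h2d
      (fun k hk => (h3 k (Finset.mem_range.2 hk)).le) hB))
  refine (pr_mono h).trans ((pr_or_le _ _).trans ?_)
  refine add_le_add ((pr_or_le _ _).trans (add_le_add (pr_or_le _ _) ?_))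
    (pr_sprinkle_fail_le hn (B + 1))
  exact (pr_exists_le _ _).trans (Finset.sum_le_sum fun k _ => pr_card_arcCycle_ge_le k ha)

lemma tendsto_cycle_term (k : ℕ) {ε : ℝ} :
    Tendsto (fun n : ℕ => (24 * ∑ v : Fin n, (1 : ℝ) / (v.val + 1)) ^ (k + 1) / (ε * n))
      atTop (𝓝 0) := by
  have hlog : Tendsto (fun n : ℕ => (Real.log n) ^ (k + 1) / n) atTop (𝓝 0) := by
    have := (Real.isLittleO_pow_log_id_atTop (n := k + 1)).tendsto_div_nhds_zero
    exact this.comp tendsto_natCast_atTop_atTop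
  have hbig := hlog.const_mul (48 ^ (k + 1) / |ε|)
  rw [mul_zero] at hbig
  refine squeeze_zero_norm' ?_ hbig
  filter_upwards [eventually_ge_atTop 3] with n hn
  have hn0 : (0 : ℝ) < n := by exact_mod_cast (by omega : 0 < n)
  have hH : ∑ v : Fin n, (1 : ℝ) / (v.val + 1) ≤ 2 * Real.log n := by
    have h1 := harmonic_le_one_add_log n
    have h2 : ((harmonic n : ℚ) : ℝ) = ∑ v : Fin n, (1 : ℝ) / (v.val + 1) := by
      rw [harmonic, Fin.sum_univ_eq_sum_range (fun i => (1 : ℝ) / ((i : ℝ) + 1))]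
      push_cast
      simp
    rw [h2] at h1
    have h3 : 1 ≤ Real.log n := by
      rw [Real.le_log_iff_exp_le hn0]
      have := Real.exp_one_lt_d9
      have : (3 : ℝ) ≤ n := by exact_mod_cast hn
      linarith
    linarith
  have h0 : (0 : ℝ) ≤ ∑ v : Fin n, (1 : ℝ) / (v.val + 1) :=
    Finset.sum_nonneg fun _ _ => by positivity
  rw [Real.norm_eq_abs, abs_div, abs_mul, abs_of_nonneg (by positivity), Nat.abs_cast]
  calc (24 * ∑ v : Fin n, (1 : ℝ) / (v.val + 1)) ^ (k + 1) / (|ε| * n) ≤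
        (24 * (2 * Real.log n)) ^ (k + 1) / (|ε| * n) := by gcongr
    _ = _ := by
      rw [← mul_assoc, mul_pow, mul_div_mul_comm]
      norm_num

/-- The decisive comparison: the potential starts at about `exp (0.7 · 10⁻⁹ n)` at most, while
`n/20000` trials gain `exp (-1.25 · 10⁻⁹ n)`. -/
lemma sprinkle_term_le {n B : ℕ} (hB : (B : ℝ) ≤ n / 10 ^ 9) :
    (2 : ℝ) ^ (B + 1) * (1 - 1 / 40000) ^ (n / 20000) ≤ 3 * Real.exp (-(1 / 10 ^ 10)) ^ n := by
  have h1 : (2 : ℝ) ^ (B + 1) ≤ 2 * Real.exp (0.7 * (n / 10 ^ 9)) := by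
    rw [pow_succ', ← Real.rpow_natCast, Real.rpow_def_of_pos (by norm_num)]
    gcongr
    have := Real.log_two_lt_d9
    linarith
  have h2 : ((1 : ℝ) - 1 / 40000) ^ (n / 20000) ≤ Real.exp (-(n / 20000 - 1) / 40000) := by
    have h3 : (1 : ℝ) - 1 / 40000 ≤ Real.exp (-(1 / 40000)) := by
      have := Real.add_one_le_exp (-(1 / 40000) : ℝ)
      linarith
    refine (pow_le_pow_left₀ (by norm_num) h3 _).trans ?_
    rw [← Real.exp_nat_mul]
    gcongr
    have h4 : (n : ℝ) < 20000 * ((n / 20000 : ℕ) + 1) := by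
      exact_mod_cast (by omega : n < 20000 * (n / 20000 + 1))
    linarith
  calc (2 : ℝ) ^ (B + 1) * (1 - 1 / 40000) ^ (n / 20000) ≤
        2 * Real.exp (0.7 * (n / 10 ^ 9)) * Real.exp (-(n / 20000 - 1) / 40000) := by
        gcongr
    _ = 2 * Real.exp (0.7 * (n / 10 ^ 9) + (-(n / 20000 - 1) / 40000)) := by
        rw [mul_assoc, ← Real.exp_add]
    _ ≤ 2 * Real.exp (0.1 + n * (-(1 / 10 ^ 10))) := by
        refine mul_le_mul_of_nonneg_left (Real.exp_le_exp.2 ?_) (by norm_num)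
        have : (0 : ℝ) ≤ n := by positivity
        linarith
    _ = (2 * Real.exp 0.1) * Real.exp (-(1 / 10 ^ 10)) ^ n := by
        rw [Real.exp_add, ← Real.exp_nat_mul, mul_assoc]
    _ ≤ _ := by
        gcongr
        have h := Real.exp_bound_div_one_sub_of_interval (x := 0.1) (by norm_num) (by norm_num)
        norm_num at h ⊢
        linarith

lemma tendsto_pr_not_isHamiltonian :
    Tendsto (fun n : ℕ => pr fun c => ¬ (graph n 13 c).IsHamiltonian) atTop (𝓝 0) := by
  -- Cycles longer than `L` cost `10⁻¹⁰ n` gaps; this `ε` makes the bad vertices and the short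
  -- cycles cost about `10⁻¹¹ n` each. The sum is well below `n/10⁹`, and `n ≥ 10³⁰` absorbs the
  -- rounding.
  set L : ℕ := 10 ^ 10 with hL
  set ε : ℝ := 1 / 10 ^ 21 with hε
  obtain ⟨θ, h0, h1, hθ⟩ := exists_pr_matchingFails_le (ε := ε) (by positivity)
  have t1 : Tendsto (fun n : ℕ => (3 : ℝ) / n) atTop (𝓝 0) :=
    tendsto_const_div_atTop_nhds_zero_nat 3
  have t2 : Tendsto (fun n : ℕ => ((n : ℝ) + 1) * (2 * Real.exp 12 * θ ^ n)) atTop (𝓝 0) := by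
    have a1 := tendsto_self_mul_const_pow_of_lt_one h0.le h1
    have a2 := tendsto_pow_atTop_nhds_zero_of_lt_one h0.le h1
    have := (a1.add a2).const_mul (2 * Real.exp 12)
    rw [add_zero, mul_zero] at this
    refine this.congr fun n => ?_
    ring
  have t3 : Tendsto (fun n : ℕ => ∑ k ∈ Finset.range L,
      (24 * ∑ v : Fin n, (1 : ℝ) / (v.val + 1)) ^ (k + 1) / (ε * n)) atTop (𝓝 0) := by
    have := tendsto_finsetSum (Finset.range L) fun k _ => tendsto_cycle_term k (ε := ε)
    rwa [Finset.sum_const_zero] at this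
  have t4 : Tendsto (fun n : ℕ => 3 * Real.exp (-(1 / 10 ^ 10)) ^ n) atTop (𝓝 0) := by
    have := (tendsto_pow_atTop_nhds_zero_of_lt_one (Real.exp_pos (-(1 / 10 ^ 10))).le
      (by rw [Real.exp_lt_one_iff]; norm_num)).const_mul 3
    rwa [mul_zero] at this
  have t := ((t1.add t2).add t3).add t4
  simp only [add_zero] at t
  refine squeeze_zero' (Eventually.of_forall fun n => pr_nonneg _) ?_ t
  filter_upwards [eventually_ge_atTop (10 ^ 30)] with n hn
  have hn' : (10 : ℝ) ^ 30 ≤ n := by exact_mod_cast hn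
  have hn0 : (0 : ℝ) < n := by linarith [show (0 : ℝ) < 10 ^ 30 by norm_num]
  set d : ℕ := ⌈ε * n⌉₊ with hd
  have hd1 : ε * n ≤ d := Nat.le_ceil _
  have hd2 : (d : ℝ) < ε * n + 1 := Nat.ceil_lt_add_one (by positivity)
  set B : ℕ := ⌊(n : ℝ) / 10 ^ 9⌋₊ with hBdef
  have hB1 : (B : ℝ) ≤ n / 10 ^ 9 := Nat.floor_le (by positivity)
  have hB2 : (n : ℝ) / 10 ^ 9 < B + 1 := Nat.lt_floor_add_one _
  have hLr : (L : ℝ) = 10 ^ 10 := by rw [hL]; norm_num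
  have hB : ((L : ℝ) + 1) * d + L * (ε * n) + n / L ≤ (B : ℝ) + 1 / 2 := by
    rw [hLr]
    have : ((10 : ℝ) ^ 10 + 1) * d ≤ (10 ^ 10 + 1) * (ε * n + 1) := by gcongr
    rw [hε] at this ⊢
    linarith
  have h2d : 2 * d ≤ n := by
    have : (2 : ℝ) * d ≤ n := by
      rw [hε] at hd2
      linarith
    exact_mod_cast this
  have hn5 : 5000 ≤ n := le_trans (by norm_num) hn
  refine (pr_not_isHamiltonian_le hn5 (by rw [hL]; positivity) (show 0 < ε * n by positivity)
    hd1 h2d hB).trans ?_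
  have hnpos : 0 < n := by omega
  exact add_le_add (add_le_add (add_le_add (pr_expansionFails_le hnpos) (hθ n hnpos)) le_rfl)
    (sprinkle_term_le hB1)

end conclusion

end UniformAttachment

theorem theorem2p3 :
    Tendsto
      (fun n : ℕ =>
        UniformAttachment.choiceMeasure n 13
          {c | (UniformAttachment.graph n 13 c).IsHamiltonian})
      atTop (𝓝 1) := by
  have h := (UniformAttachment.tendsto_pr_not_isHamiltonian).const_sub 1
  rw [sub_zero] at h
  have h2 := ENNReal.tendsto_ofReal h
  rw [ENNReal.ofReal_one] at h2
  refine h2.congr fun n => ?_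
  rw [UniformAttachment.choiceMeasure_eq, ← UniformAttachment.pr_not]
  rfl
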